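/- Let $R$ be a commutative $\mathbb{Q}$-algebra and let $k\ge 3$ be an odd integer. "Functions" are formal power series over $R$ in $z$ and in the times $t=(t_1,t_3,t_5,\dots)$, where $x=t_1$ and the $k$-th time is denoted $\bar t_k$; subscripts denote partial derivatives and $\partial=\partial_x$. Put $\xi(t,\lambda)=\bar t_k\lambda^k+\sum_{n\neq k,\ n\text{ odd}}t_n\lambda^n$. Pseudo-differential operators $P=\sum_{i\le N}a_i(z,t)\partial^i$ are multiplied by $\partial^i a=\sum_{l\ge0}\binom{i}{l}a^{(l)}\partial^{i-l}$, where $a^{(l)}=\partial_x^l a$; write $P_+=\sum_{i\ge0}a_i\partial^i$, $P_-=\sum_{i<0}a_i\partial^i$, $P^*=\sum_i(-\partial)^i a_i$, $P(e^{\xi(t,\lambda)})=\sum_i a_i\lambda^i e^{\xi(t,\lambda)}$. Let $\operatorname{res}_\lambda$ denote the coefficient of $\lambda^{-1}$. Let $W=1+\sum_{i\ge1}w_i(z,t)\partial^{-i}$, let $w(z,t,\lambda)=W(e^{\xi(t,\lambda)})=\bigl(1+\sum_{i\ge1}w_i(z,t)\lambda^{-i}\bigr)e^{\xi(t,\lambda)}$,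 and let $q(z,t)$, $r(z,t)$ be functions. Suppose that, as formal power series in $z$ and two independent sets of times $t,t'$ (with $x'=t'_1$, and $\bar t_k'$ the $k$-th entry of $t'$), \begin{align*} &\operatorname{res}_\lambda \lambda^{-1}w(z-\bar t_k,t,\lambda)\,w(z-\bar t_k',t',-\lambda)=1,\\ &\operatorname{res}_\lambda \lambda^{-1}w_z(z-\bar t_k,t,\lambda)\,w(z-\bar t_k',t',-\lambda)=q(z-\bar t_k,t)\,r(z-\bar t_k',t')-r(z-\bar t_k,t)\,q(z-\bar t_k',t'),\\ &q(z-\bar t_k,t)=\operatorname{res}_\lambda \lambda^{-1}w(z-\bar t_k,t,\lambda)\,\partial_{x'}^{-1}\bigl(q(z-\bar t_k',t')\,w_{x'}(z-\bar t_k',t',-\lambda)\bigr),\\ &r(z-\bar t_k,t)=\operatorname{res}_\lambda \lambda^{-1}w(z-\bar t_k,t,\lambda)\,\partial_{x'}^{-1}\bigl(r(z-\bar t_k',t')\,w_{x'}(z-\bar t_k',t',-\lambda)\bigr), \end{align*} where $w_z$ is the derivative of $w$ in its first argument and $\partial^{-1}(f w_x)$ means $(\partial^{-1}f\,\partial W)(e^{\xi})$.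 Then $W$ is invertible, and $L=W\partial W^{-1}$, which has the form $\partial+\sum_{i\ge1}u_i\partial^{-i}$, together with $q$ and $r$ solves the extended BKP hierarchy: with $B_n=(L^n)_+$, \begin{align*} &\partial_{\bar t_k}L=[\,B_k+r\partial^{-1}q_x-q\partial^{-1}r_x,\;L\,],\qquad L^*=-\partial L\partial^{-1},\\ &L_{t_n}=[B_n,L],\qquad q_{t_n}=B_n(q),\qquad r_{t_n}=B_n(r)\qquad(n\text{ odd},\ n\ge 1,\ n\neq k). \end{align*} Moreover $\partial_{\bar t_k}W=-(L^k)_-W+(r\partial^{-1}q_x-q\partial^{-1}r_x)W$. -/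

import Mathlib

/-!
# Objects of the extended BKP hierarchy

Functions of `z` and of the times `t = (t₁, t₃, t₅, …)` are formal power series with
coefficients in a commutative `ℚ`-algebra `R`; `x = t₁`, and for the distinguished odd `k` the
variable `t k` is the time `t̄_k`.
-/

noncomputable section

namespace ExtBKP

open MvPowerSeries

/-- Positive odd integers, the indices of the times. -/
abbrev OddNat : Type := {n : ℕ // Odd n}

/-- The variables `z, t₁, t₃, t₅, …`. -/
inductive Var : Type
  | z : Var
  | t (n : OddNat) : Var

/-- The variables `z, t₁, t₃, …, t₁', t₃', …` of the bilinear identities. -/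
inductive Var2 : Type
  | z : Var2
  | t (n : OddNat) : Var2
  | t' (n : OddNat) : Var2

/-- The space variable `x = t₁`. -/
def x : Var := .t ⟨1, odd_one⟩

/-- Functions of `z, t`. -/
abbrev Fn (R : Type*) := MvPowerSeries Var R

/-- Functions of `z, t, t'`. -/
abbrev Fn2 (R : Type*) := MvPowerSeries Var2 R

section

variable {R : Type*} [CommRing R]

/-- The partial derivative of a function with respect to one of the variables. -/
def pd (v : Var) (f : Fn R) : Fn R := pderiv R v f

end

/-! ### Pseudo-differential operators -/

/-- Formal pseudo-differential operators `∑_{i ≤ N} a_i ∂^i`, with `∂ = ∂_x`; `coeff i` is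
`a_i`. -/
@[ext]
structure PDO (R : Type*) [CommRing R] where
  /-- The coefficient `a_i` of `∂^i`. -/
  coeff : ℤ → Fn R
  bdd : ∃ N : ℤ, ∀ i : ℤ, N < i → coeff i = 0

namespace PDO

variable {R : Type*} [CommRing R]

instance : Zero (PDO R) := ⟨⟨fun _ => 0, 0, fun _ _ => rfl⟩⟩

instance : Add (PDO R) :=
  ⟨fun P Q => ⟨fun i => P.coeff i + Q.coeff i, by
    obtain ⟨M, hM⟩ := P.bdd
    obtain ⟨N, hN⟩ := Q.bdd
    exact ⟨max M N, fun i hi => by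
      rw [hM i (lt_of_le_of_lt (le_max_left _ _) hi),
        hN i (lt_of_le_of_lt (le_max_right _ _) hi), add_zero]⟩⟩⟩

instance : Neg (PDO R) :=
  ⟨fun P => ⟨fun i => -P.coeff i, by
    obtain ⟨M, hM⟩ := P.bdd
    exact ⟨M, fun i hi => by rw [hM i hi, neg_zero]⟩⟩⟩

instance : Sub (PDO R) := ⟨fun P Q => P + -Q⟩

/-- The monomial operator `a ∂^n`. -/
def monomial (n : ℤ) (a : Fn R) : PDO R where
  coeff i := if i = n then a else 0
  bdd := ⟨n, fun _ hi => if_neg hi.ne'⟩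

/-- Multiplication by a function, as an operator of order zero. -/
def ofFn (a : Fn R) : PDO R := monomial 0 a

/-- The operator `∂`. -/
def partialX : PDO R := monomial 1 1

/-- The operator `∂⁻¹`. -/
def partialXInv : PDO R := monomial (-1) 1

instance : One (PDO R) := ⟨ofFn 1⟩

/-- The composition of operators, from
`a ∂^i ∘ b ∂^j = ∑_{l ≥ 0} binom(i, l) a (∂_x^l b) ∂^(i + j - l)`.  The coefficient of `∂^n`
collects the (finitely many) nonzero terms with `j = n - i + l`. -/
def mul (P Q : PDO R) : PDO R where
  coeff n := ∑ᶠ p : ℤ × ℕ,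
    Ring.choose p.1 p.2 • (P.coeff p.1 * (pd x)^[p.2] (Q.coeff (n - p.1 + p.2)))
  bdd := by
    obtain ⟨M, hM⟩ := P.bdd
    obtain ⟨N, hN⟩ := Q.bdd
    refine ⟨M + N, fun n hn => ?_⟩
    have h0 : ∀ l : ℕ, (pd x)^[l] (0 : Fn R) = 0 := fun l => by
      induction l with
      | zero => rfl
      | succ l ih => rw [Function.iterate_succ_apply', ih, pd, map_zero]
    rw [← finsum_zero (α := ℤ × ℕ)]
    refine finsum_congr fun p => ?_
    by_cases h : M < p.1
    · rw [hM _ h, zero_mul, smul_zero]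
    · rw [hN (n - p.1 + p.2) (by omega), h0, mul_zero, smul_zero]

instance : Mul (PDO R) := ⟨mul⟩

/-- Powers of an operator with respect to composition. -/
def pow (P : PDO R) : ℕ → PDO R
  | 0 => 1
  | n + 1 => pow P n * P

instance : Pow (PDO R) ℕ := ⟨pow⟩

/-- The commutator `[P, Q] = PQ - QP`. -/
def comm (P Q : PDO R) : PDO R := P * Q - Q * P

/-- The non-negative (differential) part `P_+`. -/
def pos (P : PDO R) : PDO R where
  coeff i := if 0 ≤ i then P.coeff i else 0
  bdd := by
    obtain ⟨M, hM⟩ := P.bdd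
    exact ⟨M, fun i hi => by rw [hM i hi, ite_self]⟩

/-- The negative part `P_-`. -/
def neg (P : PDO R) : PDO R where
  coeff i := if i < 0 then P.coeff i else 0
  bdd := by
    obtain ⟨M, hM⟩ := P.bdd
    exact ⟨M, fun i hi => by rw [hM i hi, ite_self]⟩

/-- The formal adjoint `P^* = ∑ (-∂)^i a_i = ∑_i ∑_{l ≥ 0} (-1)^i binom(i, l) a_i^{(l)} ∂^(i - l)`.
The coefficient of `∂^n` collects the (finitely many) nonzero terms with `i = n + l`. -/
def adjoint (P : PDO R) : PDO R where
  coeff n := ∑ᶠ l : ℕ,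
    ((Int.negOnePow (n + l) : ℤ) * Ring.choose (n + l) l) • (pd x)^[l] (P.coeff (n + l))
  bdd := by
    obtain ⟨M, hM⟩ := P.bdd
    refine ⟨M, fun n hn => ?_⟩
    have h0 : ∀ l : ℕ, (pd x)^[l] (0 : Fn R) = 0 := fun l => by
      induction l with
      | zero => rfl
      | succ l ih => rw [Function.iterate_succ_apply', ih, pd, map_zero]
    rw [← finsum_zero (α := ℕ)]
    refine finsum_congr fun l => ?_
    rw [hM (n + l) (by omega), h0, smul_zero]

/-- The derivative of the coefficients of an operator with respect to one of the variables. -/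
def deriv (v : Var) (P : PDO R) : PDO R where
  coeff i := pd v (P.coeff i)
  bdd := by
    obtain ⟨M, hM⟩ := P.bdd
    exact ⟨M, fun i hi => by rw [hM i hi, pd, map_zero]⟩

/-- The value `P(f) = ∑_{i ≥ 0} a_i ∂_x^i f` of a differential operator `P` (an operator
without negative part) on a function. -/
def act (P : PDO R) (f : Fn R) : Fn R := ∑ᶠ i : ℕ, P.coeff i * (pd x)^[i] f

/-- `W` has the form `1 + ∑_{i ≥ 1} w_i ∂^{-i}`. -/
def IsDressing (W : PDO R) : Prop := W.coeff 0 = 1 ∧ ∀ i, 0 < i → W.coeff i = 0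

end PDO

/-! ### Wave functions

A series in `λ` is a Laurent series in the variable `λ⁻¹`, so that `LaurentSeries R` stands for
`R((λ⁻¹))`.  A wave function, multiplied out, is a power series in the variables with
coefficients in `R((λ⁻¹))`: each coefficient of `exp ξ(t, λ)` is a polynomial in `λ`. -/

section Wave

variable {R : Type*} [CommRing R]

/-- The monomial `λ^n` of `R((λ⁻¹))`. -/
def lam (n : ℤ) : LaurentSeries R := HahnSeries.single (-n) 1

/-- The function `∑ a_i λ^i` of `z, t, λ` for a pseudo-differential operator `∑ a_i ∂^i`. -/
def symbol (P : PDO R) : Fn (LaurentSeries R) := fun d =>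
  HahnSeries.ofSuppBddBelow (fun n => coeff d (P.coeff (-n))) (by
    obtain ⟨M, hM⟩ := P.bdd
    refine ⟨-M, fun n hn => ?_⟩
    by_contra h
    exact hn (by simp only [hM (-n) (by omega), map_zero]))

/-- `ξ(t, λ) = ∑_{n odd} t_n λ^n`; in each degree at most one term is nonzero. -/
def xi : Fn (LaurentSeries R) := fun d =>
  ∑ᶠ n : OddNat, coeff d (C (lam (n.1 : ℤ)) * X (Var.t n) : Fn (LaurentSeries R))

/-- `exp ξ(t, λ)`. -/
def expXi [Algebra ℚ R] : Fn (LaurentSeries R) :=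
  PowerSeries.subst xi (PowerSeries.exp (LaurentSeries R))

/-- The result `P(e^ξ) = (∑ a_i λ^i) e^ξ` of applying `P = ∑ a_i ∂^i` to `e^{ξ(t, λ)}`. -/
def applyExp [Algebra ℚ R] (P : PDO R) : Fn (LaurentSeries R) := symbol P * expXi

/-- The substitution `λ ↦ -λ` on `R((λ⁻¹))`. -/
def negLamCoeff (f : LaurentSeries R) : LaurentSeries R where
  coeff n := (Int.negOnePow n : ℤ) • f.coeff n
  isPWO_support' := f.isPWO_support.mono fun n hn h => hn (by simp only [h, smul_zero])

/-- The substitution `λ ↦ -λ`: the function `f(z, t, -λ)`. -/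
def negLam (f : Fn (LaurentSeries R)) : Fn (LaurentSeries R) := fun d => negLamCoeff (coeff d f)

/-- The residue in `λ`, that is, the coefficient of `λ⁻¹`. -/
def resLam (f : Fn2 (LaurentSeries R)) : Fn2 R := fun d => (coeff d f).coeff 1

/-- `f(z - t̄_k, t)`, with `t̄_k` the variable `t k`. -/
def shift (k : OddNat) (f : Fn R) : Fn2 R :=
  subst (S := R) (fun
    | .z => X .z - X (.t k)
    | .t n => X (.t n) : Var → Fn2 R) f

/-- `f(z - t̄_k', t')`, with `t̄_k'` the variable `t' k`. -/
def shift' (k : OddNat) (f : Fn R) : Fn2 R :=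
  subst (S := R) (fun
    | .z => X .z - X (.t' k)
    | .t n => X (.t' n) : Var → Fn2 R) f

end Wave

/-! ### The bilinear identities and the hierarchy -/

section Hierarchy

variable {R : Type*} [CommRing R]

/-- The operator `r ∂⁻¹ q_x - q ∂⁻¹ r_x`. -/
def ghost (q r : Fn R) : PDO R :=
  PDO.ofFn r * PDO.partialXInv * PDO.ofFn (pd x q) -
    PDO.ofFn q * PDO.partialXInv * PDO.ofFn (pd x r)

/-- The residue identities for `w = W e^ξ`, `q` and `r`.  Here `∂⁻¹(f w_x)` is
`(∂⁻¹ f ∂ W)(e^ξ)`. -/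
structure BilinearIdentities [Algebra ℚ R] (k : OddNat) (W : PDO R) (q r : Fn R) : Prop where
  /-- `res λ⁻¹ w(z - t̄_k, t, λ) w(z - t̄_k', t', -λ) = 1`. -/
  wave_wave :
    resLam (C (lam (-1)) * shift k (applyExp W) * shift' k (negLam (applyExp W))) = 1
  /-- `res λ⁻¹ w_z(z - t̄_k, t, λ) w(z - t̄_k', t', -λ) = q r' - r q'`. -/
  waveZ_wave :
    resLam (C (lam (-1)) * shift k (pd .z (applyExp W)) * shift' k (negLam (applyExp W))) =
      shift k q * shift' k r - shift k r * shift' k q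
  /-- `q(z - t̄_k, t) = res λ⁻¹ w(z - t̄_k, t, λ) ∂⁻¹_{x'}(q' w_{x'}(z - t̄_k', t', -λ))`. -/
  eq_q :
    shift k q = resLam (C (lam (-1)) * shift k (applyExp W) *
      shift' k (negLam (applyExp (PDO.partialXInv * PDO.ofFn q * PDO.partialX * W))))
  /-- `r(z - t̄_k, t) = res λ⁻¹ w(z - t̄_k, t, λ) ∂⁻¹_{x'}(r' w_{x'}(z - t̄_k', t', -λ))`. -/
  eq_r :
    shift k r = resLam (C (lam (-1)) * shift k (applyExp W) *
      shift' k (negLam (applyExp (PDO.partialXInv * PDO.ofFn r * PDO.partialX * W))))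

/-- `L = ∂ + ∑_{i ≥ 1} u_i ∂^{-i}`, `q` and `r` solve the extended BKP hierarchy, in which the
`k`-th flow is replaced by the flow of `t̄_k`; here `B_n = (L^n)_+`. -/
structure ExtendedBKP (k : OddNat) (L : PDO R) (q r : Fn R) : Prop where
  coeff_one : L.coeff 1 = 1
  coeff_zero : L.coeff 0 = 0
  coeff_gt : ∀ i, 1 < i → L.coeff i = 0
  flow_bar : L.deriv (.t k) = ((L ^ k.1).pos + ghost q r).comm L
  flow : ∀ n : OddNat, n ≠ k → L.deriv (.t n) = (L ^ n.1).pos.comm L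
  constraint : L.adjoint = -(PDO.partialX * L * PDO.partialXInv)
  flow_q : ∀ n : OddNat, n ≠ k → pd (.t n) q = (L ^ n.1).pos.act q
  flow_r : ∀ n : OddNat, n ≠ k → pd (.t n) r = (L ^ n.1).pos.act r

end Hierarchy

end ExtBKP

end

/-! Everything reduces to one dictionary between residues in `λ` and residues of operators. Since
`ξ` contains only odd powers of `λ`, the factors `e^{ξ(t,λ)}` and `e^{ξ(t,-λ)}` cancel on the
diagonal, and `res λ⁻¹ P(e^ξ)(λ) · Q(e^ξ)(-λ)` becomes the coefficient of `∂⁻¹` in `P ∂⁻¹ Q^*`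
(`lamCoeff_one_wave_mul_wave`). If a bilinear identity is differentiated `j` times in `t₁'` before
`t' = t` is set, the same dictionary gives the coefficient of `∂^(-1-j)`. Hence a bilinear identity
determines the whole negative part of `P ∂⁻¹ Q^*` (`coeff_of_bilin_wave`). As `k ≠ 1`,
differentiation in `x` does not see the shift `z - t̄_k`.

The first identity then says `W ∂⁻¹ W^* = ∂⁻¹`. So `V = ∂⁻¹ W^* ∂` inverts `W`, and the constraint
on `L^*` follows. Its derivative in `t_n`, `n ≠ k`, says that `W_{t_n} W⁻¹ + L^n` has no negative
part. In its derivative in `t̄_k` the shift produces the extra term `-w_z`, which the second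
identity evaluates; the negative part is now `r ∂⁻¹ q_x - q ∂⁻¹ r_x`. These are the Sato equations,
and conjugation of `∂` turns them into the Lax equations (`deriv_dressing`).

The last two identities reproduce `q` and `r` from `w`. Differentiating them in `t_n` replaces `W`
by `B_n W`, and the residue of `B_n` composed with the reproducing operator is `B_n(q)`,
respectively `B_n(r)` (`coeff_neg_one_pos_mul`). -/

noncomputable section

namespace ExtBKP

open MvPowerSeries

/-! ### Calculus of the partial derivatives. -/

section

variable {R : Type*} [CommRing R]

lemma pd_zero (v : Var) : pd v (0 : Fn R) = 0 := map_zero _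

lemma pd_one (v : Var) : pd v (1 : Fn R) = 0 := pderiv_one

lemma pd_zsmul (v : Var) (m : ℤ) (f : Fn R) : pd v (m • f) = m • pd v f := map_zsmul _ _ _

lemma pd_sum {ι : Type*} (v : Var) (s : Finset ι) (f : ι → Fn R) :
    pd v (∑ i ∈ s, f i) = ∑ i ∈ s, pd v (f i) := map_sum _ _ _

lemma pd_mul (v : Var) (f g : Fn R) : pd v (f * g) = pd v f * g + f * pd v g := by
  rw [pd, Derivation.leibniz, smul_eq_mul, smul_eq_mul, add_comm, mul_comm g]; rfl

lemma pd_comm (v w : Var) (f : Fn R) : pd v (pd w f) = pd w (pd v f) := by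
  ext d
  simp only [pd, coeff_pderiv, add_right_comm d, Finsupp.add_apply]
  rcases eq_or_ne v w with rfl | h
  · rfl
  · rw [Finsupp.single_eq_of_ne h, Finsupp.single_eq_of_ne h.symm]
    push_cast
    ring

lemma iterate_pd_zero (v : Var) (l : ℕ) : (pd v)^[l] (0 : Fn R) = 0 :=
  iterate_map_zero (pderiv R v) l

lemma iterate_pd_add (v : Var) (l : ℕ) (f g : Fn R) :
    (pd v)^[l] (f + g) = (pd v)^[l] f + (pd v)^[l] g :=
  iterate_map_add (pderiv R v) l f g

lemma iterate_pd_one (v : Var) (l : ℕ) (hl : l ≠ 0) : (pd v)^[l] (1 : Fn R) = 0 := by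
  obtain ⟨l, rfl⟩ := Nat.exists_eq_succ_of_ne_zero hl
  rw [Function.iterate_succ_apply, pd_one, iterate_pd_zero]

lemma pd_iterate_pd (v w : Var) (l : ℕ) (f : Fn R) :
    pd v ((pd w)^[l] f) = (pd w)^[l] (pd v f) :=
  (Function.Commute.iterate_right (fun g => pd_comm v w g) l) f

end

/-! ### The ring of pseudo-differential operators. -/

namespace PDO

variable {R : Type*} [CommRing R]

@[simp] lemma coeff_add (P Q : PDO R) (i : ℤ) : (P + Q).coeff i = P.coeff i + Q.coeff i := rfl

@[simp] lemma coeff_zero (i : ℤ) : (0 : PDO R).coeff i = 0 := rfl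

@[simp] lemma coeff_neg (P : PDO R) (i : ℤ) : (-P).coeff i = -P.coeff i := rfl

@[simp] lemma coeff_sub (P Q : PDO R) (i : ℤ) : (P - Q).coeff i = P.coeff i - Q.coeff i :=
  (sub_eq_add_neg _ _).symm

instance : AddCommGroup (PDO R) where
  add_assoc P Q S := by ext1; funext i; simp [add_assoc]
  zero_add P := by ext1; funext i; simp
  add_zero P := by ext1; funext i; simp
  add_comm P Q := by ext1; funext i; simp [add_comm]
  neg_add_cancel P := by ext1; funext i; simp
  sub_eq_add_neg _ _ := rfl
  nsmul := nsmulRec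
  zsmul := zsmulRec

lemma coeff_monomial (n i : ℤ) (a : Fn R) :
    (monomial n a).coeff i = if i = n then a else 0 := rfl

@[simp] lemma coeff_monomial_self (n : ℤ) (a : Fn R) : (monomial n a).coeff n = a := if_pos rfl

lemma coeff_monomial_of_ne {n i : ℤ} (h : i ≠ n) (a : Fn R) : (monomial n a).coeff i = 0 :=
  if_neg h

lemma monomial_zero (n : ℤ) : monomial n (0 : Fn R) = 0 := by
  ext1; funext i; simp [coeff_monomial]

lemma one_def : (1 : PDO R) = monomial 0 1 := rfl

/-- The order of the operator `P` is at most `N`. -/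
def OrdLE (P : PDO R) (N : ℤ) : Prop := ∀ i, N < i → P.coeff i = 0

lemma exists_ordLE (P : PDO R) : ∃ N, P.OrdLE N := P.bdd

lemma OrdLE.mono {P : PDO R} {M N : ℤ} (h : P.OrdLE M) (hMN : M ≤ N) : P.OrdLE N :=
  fun i hi => h i (by omega)

lemma OrdLE.add {P Q : PDO R} {N : ℤ} (hP : P.OrdLE N) (hQ : Q.OrdLE N) : (P + Q).OrdLE N :=
  fun i hi => by simp [hP i hi, hQ i hi]

lemma OrdLE.neg {P : PDO R} {N : ℤ} (hP : P.OrdLE N) : (-P).OrdLE N :=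
  fun i hi => by simp [hP i hi]

lemma OrdLE.sub {P Q : PDO R} {N : ℤ} (hP : P.OrdLE N) (hQ : Q.OrdLE N) : (P - Q).OrdLE N :=
  fun i hi => by simp [hP i hi, hQ i hi]

lemma ordLE_monomial (n : ℤ) (a : Fn R) : (monomial n a).OrdLE n :=
  fun _ hi => if_neg hi.ne'

/-- The operator `P` is a finite sum of monomials up to an operator of order at most `c`. -/
lemma exists_sum_monomial_sub (P : PDO R) (c : ℤ) :
    ∃ s : Finset ℤ, (P - ∑ i ∈ s, monomial i (P.coeff i)).OrdLE c := by
  obtain ⟨N, hN⟩ := P.exists_ordLE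
  refine ⟨Finset.Ioc c N, fun j hj => ?_⟩
  have hc : ∀ s : Finset ℤ, (∑ i ∈ s, monomial i (P.coeff i)).coeff j =
      if j ∈ s then P.coeff j else 0 := by
    intro s
    induction s using Finset.induction_on with
    | empty => simp
    | insert a s ha ih =>
      rw [Finset.sum_insert ha, coeff_add, ih, coeff_monomial]
      by_cases h : j = a
      · subst h; simp [ha]
      · simp [h]
  rw [coeff_sub, hc]
  split_ifs with h
  · exact sub_self _
  · rw [hN j (by rw [Finset.mem_Ioc] at h; omega), sub_zero]

/-- Two additive maps which depend only on the coefficients of large order and which agree on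
monomials are equal. -/
lemma addHom_eq_of_monomial {B : Type*} [AddCommGroup B] (f g : PDO R →+ B)
    (hf : ∃ c, ∀ P : PDO R, P.OrdLE c → f P = 0) (hg : ∃ c, ∀ P : PDO R, P.OrdLE c → g P = 0)
    (h : ∀ i a, f (monomial i a) = g (monomial i a)) (P : PDO R) : f P = g P := by
  obtain ⟨c, hc⟩ := hf
  obtain ⟨d, hd⟩ := hg
  obtain ⟨s, hs⟩ := P.exists_sum_monomial_sub (min c d)
  have h1 := hc _ (hs.mono (min_le_left _ _))
  have h2 := hd _ (hs.mono (min_le_right _ _))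
  rw [map_sub, sub_eq_zero, map_sum] at h1 h2
  rw [h1, h2]
  exact Finset.sum_congr rfl fun i _ => h i _

/-- The coefficient of `∂^n` as an additive map. -/
def coeffHom (n : ℤ) : PDO R →+ Fn R where
  toFun P := P.coeff n
  map_zero' := rfl
  map_add' _ _ := rfl

/-! #### The product -/

lemma coeff_mul_eq_finsum (P Q : PDO R) (n : ℤ) : (P * Q).coeff n = ∑ᶠ p : ℤ × ℕ,
    Ring.choose p.1 p.2 • (P.coeff p.1 * (pd x)^[p.2] (Q.coeff (n - p.1 + p.2))) := rfl

/-- A nonzero term needs `i ≤ M` and `n - i + l ≤ N`, hence `i ≥ n - N` and `l ≤ M + N - n`. The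
bounds `m` and `K` are left free so that several products can be summed over one box. -/
lemma coeff_mul_eq_sum {P Q : PDO R} {M N m n : ℤ} {K : ℕ} (hP : P.OrdLE M) (hQ : Q.OrdLE N)
    (hm : m ≤ n - N) (hK : M + N - n < K) :
    (P * Q).coeff n = ∑ p ∈ Finset.Icc m M ×ˢ Finset.range K,
      Ring.choose p.1 p.2 • (P.coeff p.1 * (pd x)^[p.2] (Q.coeff (n - p.1 + p.2))) := by
  rw [coeff_mul_eq_finsum]
  refine finsum_eq_sum_of_support_subset _ fun p hp => ?_
  rw [Function.mem_support] at hp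
  have h1 : p.1 ≤ M := by
    by_contra h
    exact hp (by rw [hP _ (by omega), zero_mul, smul_zero])
  have h2 : n - p.1 + p.2 ≤ N := by
    by_contra h
    exact hp (by rw [hQ _ (by omega), iterate_pd_zero, mul_zero, smul_zero])
  simp only [Finset.coe_product, Set.mem_prod, Finset.coe_Icc, Set.mem_Icc, Finset.coe_range,
    Set.mem_Iio]
  omega

protected lemma add_mul' (P P' Q : PDO R) : (P + P') * Q = P * Q + P' * Q := by
  obtain ⟨M, hM⟩ := P.exists_ordLE
  obtain ⟨M', hM'⟩ := P'.exists_ordLE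
  obtain ⟨N, hN⟩ := Q.exists_ordLE
  replace hM := hM.mono (le_max_left M M')
  replace hM' := hM'.mono (le_max_right M M')
  ext1; funext n
  have hK : max M M' + N - n < ((max M M' + N - n + 1).toNat : ℤ) := by omega
  rw [coeff_add, coeff_mul_eq_sum (hM.add hM') hN le_rfl hK, coeff_mul_eq_sum hM hN le_rfl hK,
    coeff_mul_eq_sum hM' hN le_rfl hK, ← Finset.sum_add_distrib]
  exact Finset.sum_congr rfl fun p _ => by rw [coeff_add, add_mul, smul_add]

protected lemma mul_add' (P Q Q' : PDO R) : P * (Q + Q') = P * Q + P * Q' := by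
  obtain ⟨M, hM⟩ := P.exists_ordLE
  obtain ⟨N, hN⟩ := Q.exists_ordLE
  obtain ⟨N', hN'⟩ := Q'.exists_ordLE
  replace hN := hN.mono (le_max_left N N')
  replace hN' := hN'.mono (le_max_right N N')
  ext1; funext n
  have hK : M + max N N' - n < ((M + max N N' - n + 1).toNat : ℤ) := by omega
  rw [coeff_add, coeff_mul_eq_sum hM (hN.add hN') le_rfl hK, coeff_mul_eq_sum hM hN le_rfl hK,
    coeff_mul_eq_sum hM hN' le_rfl hK, ← Finset.sum_add_distrib]
  exact Finset.sum_congr rfl fun p _ => by rw [coeff_add, iterate_pd_add, mul_add, smul_add]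

lemma OrdLE.mul {P Q : PDO R} {M N : ℤ} (hP : P.OrdLE M) (hQ : Q.OrdLE N) :
    (P * Q).OrdLE (M + N) := fun n hn => by
  rw [coeff_mul_eq_sum hP hQ (m := M + 1) (by omega) (K := 0) (by push_cast; omega)]
  simp

/-- The product as a biadditive map. -/
def mulHom : PDO R →+ PDO R →+ PDO R :=
  AddMonoidHom.mk' (fun P => AddMonoidHom.mk' (fun Q => P * Q) (PDO.mul_add' P))
    fun P P' => by ext1 Q; exact PDO.add_mul' P P' Q

lemma mulHom_apply (P Q : PDO R) : mulHom P Q = P * Q := rfl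

lemma coeff_monomial_mul {Q : PDO R} {N n i : ℤ} {K : ℕ} (hQ : Q.OrdLE N) (hK : i + N - n < K)
    (a : Fn R) : (monomial i a * Q).coeff n =
      ∑ l ∈ Finset.range K, Ring.choose i l • (a * (pd x)^[l] (Q.coeff (n - i + l))) := by
  -- The lower bound `min (n - N) i` keeps the index `i` itself inside the box.
  rw [coeff_mul_eq_sum (ordLE_monomial i a) hQ (min_le_left (n - N) i) hK, Finset.sum_product,
    Finset.sum_eq_single i]
  · simp
  · intro j _ hj
    simp [coeff_monomial_of_ne hj]
  · intro h
    simp at h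

lemma coeff_ofFn_mul (a : Fn R) (Q : PDO R) (n : ℤ) : (ofFn a * Q).coeff n = a * Q.coeff n := by
  obtain ⟨N, hN⟩ := Q.exists_ordLE
  rw [ofFn, coeff_monomial_mul hN (K := (N - n).toNat + 1) (by omega), Finset.sum_range_succ']
  simp [Ring.choose_zero_succ]

lemma coeff_partialX_mul (Q : PDO R) (n : ℤ) :
    (partialX * Q).coeff n = pd x (Q.coeff n) + Q.coeff (n - 1) := by
  obtain ⟨N, hN⟩ := Q.exists_ordLE
  have h : ∀ l : ℕ, Ring.choose (1 : ℤ) (l + 1 + 1) = 0 := fun l => by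
    have := Ring.choose_natCast (R := ℤ) 1 (l + 1 + 1)
    rw [Nat.cast_one] at this
    rw [this]; simp [Nat.choose_eq_zero_of_lt]
  rw [partialX, coeff_monomial_mul hN (K := (N - n).toNat + 1 + 1) (by omega),
    Finset.sum_range_succ', Finset.sum_range_succ']
  simp [h]

lemma coeff_mul_monomial_one (P : PDO R) (j n : ℤ) :
    (P * monomial j 1).coeff n = P.coeff (n - j) := by
  rw [coeff_mul_eq_finsum, finsum_eq_single _ (n - j, 0)]
  · simp
  · rintro ⟨i, l⟩ h
    rcases eq_or_ne l 0 with rfl | hl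
    · have : n - i ≠ j := fun h' => h (by simp [← h'])
      simp [coeff_monomial_of_ne this]
    · rw [coeff_monomial]
      split_ifs <;> simp [iterate_pd_one _ _ hl, iterate_pd_zero]

protected lemma one_mul' (P : PDO R) : 1 * P = P := by
  ext1; funext n
  exact (coeff_ofFn_mul 1 P n).trans (one_mul _)

protected lemma mul_one' (P : PDO R) : P * 1 = P := by
  ext1; funext n
  rw [one_def, coeff_mul_monomial_one, sub_zero]

lemma ofFn_mul_monomial (a b : Fn R) (i : ℤ) : ofFn a * monomial i b = monomial i (a * b) := by
  ext1; funext n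
  rw [coeff_ofFn_mul, coeff_monomial, coeff_monomial, mul_ite, mul_zero]

lemma partialX_mul_monomial (b : Fn R) (j : ℤ) :
    partialX * monomial j b = monomial j (pd x b) + monomial (j + 1) b := by
  ext1; funext n
  rw [coeff_partialX_mul, coeff_add]
  congr 1
  · rw [coeff_monomial, coeff_monomial]
    split_ifs
    exacts [rfl, pd_zero _]
  · simp only [coeff_monomial, sub_eq_iff_eq_add]

lemma choose_neg_one (l : ℕ) : Ring.choose (-1 : ℤ) l = (-1) ^ l := by
  induction l with
  | zero => simp
  | succ l ih =>
    have h := Ring.choose_succ_succ (-1 : ℤ) l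
    rw [neg_add_cancel, Ring.choose_zero_succ, ih] at h
    rw [pow_succ]; linarith

/-- Since `binom(-1, l) = (-1)^l`, the sum telescopes and only `l = 0` survives. The factor `Q` is
carried along because associativity is not yet available. -/
lemma partialX_mul_partialXInv_mul (Q : PDO R) : partialX * (partialXInv * Q) = Q := by
  obtain ⟨N, hN⟩ := Q.exists_ordLE
  ext1; funext n
  rw [coeff_partialX_mul, partialXInv, coeff_monomial_mul hN (K := (N - n).toNat) (by omega),
    coeff_monomial_mul hN (K := (N - n).toNat + 1) (by omega), Finset.sum_range_succ', pd_sum,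
    ← add_assoc, ← Finset.sum_add_distrib,
    Finset.sum_eq_zero, zero_add]
  · simp
  · intro l _
    rw [pd_zsmul, one_mul, one_mul, choose_neg_one, choose_neg_one, Function.iterate_succ_apply',
      show n - 1 - -1 + ((l + 1 : ℕ) : ℤ) = n - -1 + l by push_cast; ring, ← add_smul, pow_succ]
    simp

/-- The top coefficient of `∂ Q` is that of `Q`, so the order of `Q` can be lowered indefinitely. -/
lemma eq_zero_of_partialX_mul_eq_zero {Q : PDO R} (h : partialX * Q = 0) : Q = 0 := by
  obtain ⟨N, hN⟩ := Q.exists_ordLE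
  have key : ∀ l : ℕ, Q.OrdLE (N - l) := by
    intro l
    induction l with
    | zero => simpa using hN
    | succ l ih =>
      intro i hi
      by_cases hi' : N - l < i
      · exact ih i hi'
      · have h1 := congrArg (fun P => P.coeff (i + 1)) h
        simp only [coeff_partialX_mul, coeff_zero] at h1
        rwa [ih (i + 1) (by push_cast at hi; omega), pd_zero, zero_add, add_sub_cancel_right]
          at h1
  ext1; funext i
  exact key (N - i + 1).toNat i (by omega)

lemma partialXInv_mul_partialX_mul (Q : PDO R) : partialXInv * (partialX * Q) = Q := by
  rw [← sub_eq_zero]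
  apply eq_zero_of_partialX_mul_eq_zero
  change mulHom partialX (_ - _) = 0
  rw [map_sub, mulHom_apply, mulHom_apply, partialX_mul_partialXInv_mul, sub_self]

lemma ofFn_mul_assoc (a : Fn R) (Q S : PDO R) : ofFn a * Q * S = ofFn a * (Q * S) := by
  ext1; funext n
  rw [coeff_ofFn_mul]
  obtain ⟨M, hM⟩ := Q.exists_ordLE
  obtain ⟨N, hN⟩ := S.exists_ordLE
  have hM' : (ofFn a * Q).OrdLE M := fun i hi => by rw [coeff_ofFn_mul, hM i hi, mul_zero]
  have hK : M + N - n < ((M + N - n + 1).toNat : ℤ) := by omega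
  rw [coeff_mul_eq_sum hM' hN le_rfl hK,
    coeff_mul_eq_sum hM hN le_rfl hK, Finset.mul_sum]
  exact Finset.sum_congr rfl fun p _ => by rw [coeff_ofFn_mul, mul_smul_comm, mul_assoc]

/-- Both sides are additive in `Q` and a fixed coefficient ignores `Q` of very negative order, so `Q
= b ∂^j` suffices. There the claim is the Leibniz rule combined with Pascal's rule for the
binomials. -/
lemma partialX_mul_assoc (Q S : PDO R) : partialX * Q * S = partialX * (Q * S) := by
  obtain ⟨N, hN⟩ := S.exists_ordLE
  ext1; funext n
  refine addHom_eq_of_monomial ((coeffHom n).comp ((mulHom.flip S).comp (mulHom partialX)))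
    ((coeffHom n).comp ((mulHom partialX).comp (mulHom.flip S))) ?_ ?_ ?_ Q
  · exact ⟨n - N - 2, fun P hP => (((ordLE_monomial 1 1).mul hP).mul hN) n (by omega)⟩
  · exact ⟨n - N - 2, fun P hP => ((ordLE_monomial 1 1).mul (hP.mul hN)) n (by omega)⟩
  intro j b
  change (partialX * monomial j b * S).coeff n = (partialX * (monomial j b * S)).coeff n
  have h1 : j + N - n < (j + N - n + 1).toNat := by omega
  have h2 : j + 1 + N - n < ((j + N - n + 1).toNat + 1 : ℕ) := by push_cast; omega
  have h3 : j + N - (n - 1) < ((j + N - n + 1).toNat + 1 : ℕ) := by push_cast; omega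
  rw [partialX_mul_monomial, PDO.add_mul', coeff_add, coeff_partialX_mul,
    coeff_monomial_mul hN h1, coeff_monomial_mul hN h1, coeff_monomial_mul hN h2,
    coeff_monomial_mul hN h3, Finset.sum_range_succ', Finset.sum_range_succ', ← add_assoc,
    ← add_assoc, pd_sum, ← Finset.sum_add_distrib, ← Finset.sum_add_distrib]
  congr 1
  · refine Finset.sum_congr rfl fun l _ => ?_
    rw [pd_zsmul, pd_mul, Ring.choose_succ_succ, ← Function.iterate_succ_apply' (pd x),
      show n - (j + 1) + ((l + 1 : ℕ) : ℤ) = n - j + l by push_cast; ring,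
      show n - 1 - j + ((l + 1 : ℕ) : ℤ) = n - j + l by push_cast; ring, add_smul, smul_add]
    abel
  · simp only [Ring.choose_zero_right, Nat.cast_zero, add_zero]
    rw [show n - (j + 1) = n - 1 - j by ring]

lemma partialXInv_mul_assoc (Q S : PDO R) : partialXInv * Q * S = partialXInv * (Q * S) := by
  have h := partialX_mul_assoc (partialXInv * Q) S
  rw [partialX_mul_partialXInv_mul] at h
  rw [h, partialXInv_mul_partialX_mul]

lemma partialX_mul_monomial_one (i : ℤ) :
    partialX * monomial i (1 : Fn R) = monomial (i + 1) 1 := by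
  rw [partialX_mul_monomial, pd_one, monomial_zero, zero_add]

lemma partialXInv_mul_monomial_one (i : ℤ) :
    partialXInv * monomial i (1 : Fn R) = monomial (i - 1) 1 := by
  rw [← partialXInv_mul_partialX_mul (monomial (i - 1) 1), partialX_mul_monomial_one,
    sub_add_cancel]

/-- A property of operators which is stable under left multiplication by functions, by `∂` and by
`∂⁻¹` holds for monomials. -/
lemma monomial_induction {p : PDO R → Prop} (one : p 1) (fn : ∀ a P, p P → p (ofFn a * P))
    (dx : ∀ P, p P → p (partialX * P)) (dxInv : ∀ P, p P → p (partialXInv * P)) (i : ℤ)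
    (a : Fn R) : p (monomial i a) := by
  have h : ∀ i : ℤ, p (monomial i 1) := by
    intro i
    induction i with
    | zero => exact one
    | succ i ih => rw [← partialX_mul_monomial_one]; exact dx _ ih
    | pred i ih => rw [← partialXInv_mul_monomial_one]; exact dxInv _ ih
  rw [← mul_one a, ← ofFn_mul_monomial]
  exact fn a _ (h i)

/-- It suffices to take a monomial for `P`. Monomials are generated by functions, `∂` and `∂⁻¹`, and
associativity with each of these as first factor is known. -/
protected lemma mul_assoc' (P Q S : PDO R) : P * Q * S = P * (Q * S) := by
  obtain ⟨M, hM⟩ := Q.exists_ordLE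
  obtain ⟨N, hN⟩ := S.exists_ordLE
  ext1; funext n
  refine addHom_eq_of_monomial ((coeffHom n).comp ((mulHom.flip S).comp (mulHom.flip Q)))
    ((coeffHom n).comp (mulHom.flip (Q * S))) ?_ ?_ ?_ P
  · exact ⟨n - M - N - 1, fun P hP => ((hP.mul hM).mul hN) n (by omega)⟩
  · exact ⟨n - M - N - 1, fun P hP => (hP.mul (hM.mul hN)) n (by omega)⟩
  intro i a
  change (monomial i a * Q * S).coeff n = (monomial i a * (Q * S)).coeff n
  congr 1
  refine monomial_induction (p := fun P => P * Q * S = P * (Q * S)) ?_ ?_ ?_ ?_ i a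
  · rw [PDO.one_mul', PDO.one_mul']
  · intro a P h
    rw [ofFn_mul_assoc, ofFn_mul_assoc, ofFn_mul_assoc, h]
  · intro P h
    rw [partialX_mul_assoc, partialX_mul_assoc, partialX_mul_assoc, h]
  · intro P h
    rw [partialXInv_mul_assoc, partialXInv_mul_assoc, partialXInv_mul_assoc, h]

instance : Ring (PDO R) where
  mul_assoc := PDO.mul_assoc'
  one_mul := PDO.one_mul'
  mul_one := PDO.mul_one'
  left_distrib := PDO.mul_add'
  right_distrib := PDO.add_mul'
  zero_mul P := map_zero (mulHom.flip P)
  mul_zero P := map_zero (mulHom P)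
  npow n P := P ^ n
  npow_zero _ := rfl
  npow_succ _ _ := rfl
  sub_eq_add_neg _ _ := rfl
  neg_add_cancel := neg_add_cancel
  zsmul := zsmulRec

lemma partialX_mul_partialXInv : partialX * partialXInv = (1 : PDO R) := by
  simpa using partialX_mul_partialXInv_mul (1 : PDO R)

lemma partialXInv_mul_partialX : partialXInv * partialX = (1 : PDO R) := by
  simpa using partialXInv_mul_partialX_mul (1 : PDO R)

end PDO

namespace PDO

variable {R : Type*} [CommRing R]

@[simp] lemma coeff_zsmul (m : ℤ) (P : PDO R) (i : ℤ) : (m • P).coeff i = m • P.coeff i :=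
  map_zsmul (coeffHom i) m P

lemma ofFn_mul_ofFn (a b : Fn R) : ofFn a * ofFn b = ofFn (a * b) := ofFn_mul_monomial a b 0

lemma ofFn_mul_monomial_one (a : Fn R) (i : ℤ) : ofFn a * monomial i 1 = monomial i a := by
  rw [ofFn_mul_monomial, mul_one]

lemma monomial_one_mul_monomial_one (i j : ℤ) :
    monomial i (1 : Fn R) * monomial j 1 = monomial (i + j) 1 := by
  ext1; funext n
  rw [coeff_mul_monomial_one]
  simp only [coeff_monomial, sub_eq_iff_eq_add]

lemma partialX_pow (n : ℕ) : (partialX : PDO R) ^ n = monomial n 1 := by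
  induction n with
  | zero => rfl
  | succ n ih =>
    rw [pow_succ, ih, partialX, monomial_one_mul_monomial_one]
    rfl

/-! #### The formal adjoint -/

lemma coeff_adjoint_eq_sum {P : PDO R} {N n : ℤ} {K : ℕ} (hP : P.OrdLE N) (hK : N - n < K) :
    P.adjoint.coeff n = ∑ l ∈ Finset.range K,
      ((Int.negOnePow (n + l) : ℤ) * Ring.choose (n + l) l) • (pd x)^[l] (P.coeff (n + l)) := by
  refine finsum_eq_sum_of_support_subset _ fun l hl => ?_
  rw [Function.mem_support] at hl
  rw [Finset.coe_range, Set.mem_Iio]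
  by_contra h
  exact hl (by rw [hP _ (by omega), iterate_pd_zero, smul_zero])

lemma OrdLE.adjoint {P : PDO R} {N : ℤ} (hP : P.OrdLE N) : P.adjoint.OrdLE N := fun n hn => by
  rw [coeff_adjoint_eq_sum hP (K := 0) (by push_cast; omega), Finset.sum_range_zero]

lemma adjoint_add (P Q : PDO R) : (P + Q).adjoint = P.adjoint + Q.adjoint := by
  obtain ⟨M, hM⟩ := P.exists_ordLE
  obtain ⟨N, hN⟩ := Q.exists_ordLE
  replace hM := hM.mono (le_max_left M N)
  replace hN := hN.mono (le_max_right M N)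
  ext1; funext n
  have hK : max M N - n < ((max M N - n + 1).toNat : ℤ) := by omega
  rw [coeff_add, coeff_adjoint_eq_sum hM hK, coeff_adjoint_eq_sum hN hK,
    coeff_adjoint_eq_sum (hM.add hN) hK, ← Finset.sum_add_distrib]
  exact Finset.sum_congr rfl fun l _ => by rw [coeff_add, iterate_pd_add, smul_add]

/-- The adjoint as an additive map. -/
def adjointHom : PDO R →+ PDO R := AddMonoidHom.mk' adjoint adjoint_add

/-- The coefficient formula for the adjoint is here identified with the composition `(-∂)^j b`; in
both expansions only the term with `n + l = j` survives. -/
lemma adjoint_monomial (j : ℤ) (b : Fn R) :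
    (monomial j b).adjoint = (j.negOnePow : ℤ) • (monomial j 1 * ofFn b) := by
  ext1; funext n
  have hK : j - n < ((j - n + 1).toNat : ℤ) := by omega
  rw [coeff_adjoint_eq_sum (ordLE_monomial j b) hK, coeff_zsmul, ofFn,
    coeff_monomial_mul (ordLE_monomial 0 b) (by omega : j + 0 - n < ((j - n + 1).toNat : ℤ)),
    Finset.smul_sum]
  refine Finset.sum_congr rfl fun l _ => ?_
  by_cases h : n + l = j
  · subst h
    simp [mul_smul]
  · rw [coeff_monomial_of_ne h, coeff_monomial_of_ne (by omega), iterate_pd_zero, mul_zero,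
      smul_zero, smul_zero, smul_zero]

lemma adjoint_one : (1 : PDO R).adjoint = 1 := by
  rw [one_def, adjoint_monomial]
  simp [ofFn, ← one_def]

lemma adjoint_partialX : (partialX : PDO R).adjoint = -partialX := by
  rw [partialX, adjoint_monomial, Int.negOnePow_one]
  change _ • (_ * (1 : PDO R)) = _
  simp

lemma adjoint_ofFn_mul (a : Fn R) (Q : PDO R) :
    (ofFn a * Q).adjoint = Q.adjoint * ofFn a := by
  ext1; funext n
  refine addHom_eq_of_monomial ((coeffHom n).comp (adjointHom.comp (mulHom (ofFn a))))
    ((coeffHom n).comp ((mulHom.flip (ofFn a)).comp adjointHom)) ?_ ?_ ?_ Q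
  · exact ⟨n - 1, fun P hP => ((ordLE_monomial 0 a).mul hP).adjoint n (by omega)⟩
  · exact ⟨n - 1, fun P hP => (hP.adjoint.mul (ordLE_monomial 0 a)) n (by omega)⟩
  intro j b
  change (ofFn a * monomial j b).adjoint.coeff n = ((monomial j b).adjoint * ofFn a).coeff n
  rw [ofFn_mul_monomial, adjoint_monomial, adjoint_monomial, smul_mul_assoc, mul_assoc,
    ofFn_mul_ofFn, mul_comm a]

lemma adjoint_partialX_mul (Q : PDO R) :
    (partialX * Q).adjoint = -(Q.adjoint * partialX) := by
  rw [← mul_neg]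
  ext1; funext n
  refine addHom_eq_of_monomial ((coeffHom n).comp (adjointHom.comp (mulHom partialX)))
    ((coeffHom n).comp ((mulHom.flip (-partialX)).comp adjointHom)) ?_ ?_ ?_ Q
  · exact ⟨n - 2, fun P hP => ((ordLE_monomial 1 1).mul hP).adjoint n (by omega)⟩
  · exact ⟨n - 2, fun P hP =>
      (hP.adjoint.mul (ordLE_monomial 1 1).neg) n (by omega)⟩
  intro j b
  change (partialX * monomial j b).adjoint.coeff n =
    ((monomial j b).adjoint * -partialX).coeff n
  congr 1
  have h1 : partialX * ofFn b = ofFn (pd x b) + ofFn b * partialX := by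
    rw [partialX, ofFn_mul_monomial_one]
    exact partialX_mul_monomial b 0
  rw [partialX_mul_monomial, adjoint_add, adjoint_monomial, adjoint_monomial, adjoint_monomial,
    Int.negOnePow_succ, ← monomial_one_mul_monomial_one]
  change _ + _ • (_ * partialX * _) = _
  rw [mul_assoc _ partialX, h1, mul_add, Units.val_neg, neg_smul, smul_add, smul_mul_assoc,
    mul_assoc, mul_neg, mul_neg, smul_neg]
  abel

/-- The rule is checked on the generators of the first factor; the case of `∂⁻¹` is forced by that
of `∂`. -/
theorem adjoint_mul (P Q : PDO R) : (P * Q).adjoint = Q.adjoint * P.adjoint := by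
  obtain ⟨N, hN⟩ := Q.exists_ordLE
  ext1; funext n
  refine addHom_eq_of_monomial ((coeffHom n).comp (adjointHom.comp (mulHom.flip Q)))
    ((coeffHom n).comp ((mulHom Q.adjoint).comp adjointHom)) ?_ ?_ ?_ P
  · exact ⟨n - N - 1, fun P hP => (hP.mul hN).adjoint n (by omega)⟩
  · exact ⟨n - N - 1, fun P hP => (hN.adjoint.mul hP.adjoint) n (by omega)⟩
  intro i a
  change (monomial i a * Q).adjoint.coeff n = (Q.adjoint * (monomial i a).adjoint).coeff n
  congr 1
  refine monomial_induction (p := fun P => (P * Q).adjoint = Q.adjoint * P.adjoint)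
    ?_ ?_ ?_ ?_ i a
  · rw [one_mul, adjoint_one, mul_one]
  · intro a P h
    rw [mul_assoc, adjoint_ofFn_mul, adjoint_ofFn_mul, h, mul_assoc]
  · intro P h
    rw [mul_assoc, adjoint_partialX_mul, adjoint_partialX_mul, h, mul_neg, mul_assoc]
  · intro P h
    have key : ∀ S : PDO R, (partialXInv * S).adjoint = -(S.adjoint * partialXInv) := by
      intro S
      have h1 := adjoint_partialX_mul (partialXInv * S)
      rw [partialX_mul_partialXInv_mul] at h1
      rw [h1, neg_mul, neg_neg, mul_assoc, partialX_mul_partialXInv, mul_one]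
    rw [mul_assoc, key, key, h, mul_neg, mul_assoc]

/-- The residue of `P Q^*`, for monomials. -/
lemma coeff_neg_one_monomial_mul_adjoint (i j : ℤ) (a b : Fn R) :
    (monomial i a * (monomial j b).adjoint).coeff (-1) =
      if i + j = -1 then (j.negOnePow : ℤ) • (a * b) else 0 := by
  rw [adjoint_monomial, mul_smul_comm, coeff_zsmul, ← ofFn_mul_monomial_one, ← mul_assoc,
    mul_assoc (ofFn a), monomial_one_mul_monomial_one, mul_assoc, coeff_ofFn_mul, ofFn,
    coeff_monomial_mul (ordLE_monomial 0 b) (K := (i + j + 2).toNat + 1) (by omega)]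
  split_ifs with h
  · rw [h, Finset.sum_eq_single 0]
    · simp
    · intro l _ hl
      rw [coeff_monomial_of_ne (by omega), iterate_pd_zero, mul_zero, smul_zero]
    · simp
  · rw [Finset.sum_eq_zero, mul_zero, smul_zero]
    intro l _
    -- A nonzero term would need `l = i + j + 1`. As `i + j ≠ -1`, this forces `m = i + j ≥ 0`, and
    -- `binom(m, m + 1) = 0`: a differential operator has no residue.
    by_cases hl : -1 - (i + j) + l = 0
    · obtain ⟨m, hm⟩ : ∃ m : ℕ, i + j = m := ⟨(i + j).toNat, by omega⟩
      have : l = m + 1 := by omega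
      rw [hm, Ring.choose_natCast, this, Nat.choose_succ_self, Nat.cast_zero, zero_smul]
    · rw [coeff_monomial_of_ne hl, iterate_pd_zero, mul_zero, smul_zero]

/-! #### Differentiation of the coefficients -/

@[simp] lemma coeff_deriv (v : Var) (P : PDO R) (i : ℤ) :
    (P.deriv v).coeff i = pd v (P.coeff i) := rfl

lemma OrdLE.deriv {P : PDO R} {N : ℤ} (hP : P.OrdLE N) (v : Var) : (P.deriv v).OrdLE N :=
  fun i hi => by rw [coeff_deriv, hP i hi, pd_zero]

lemma deriv_monomial_one (v : Var) (n : ℤ) : (monomial n (1 : Fn R)).deriv v = 0 := by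
  ext1; funext i
  rw [coeff_deriv, coeff_monomial]
  split_ifs
  exacts [pd_one v, pd_zero v]

lemma deriv_mul (v : Var) (P Q : PDO R) :
    (P * Q).deriv v = P.deriv v * Q + P * Q.deriv v := by
  obtain ⟨M, hM⟩ := P.exists_ordLE
  obtain ⟨N, hN⟩ := Q.exists_ordLE
  ext1; funext n
  have hK : M + N - n < ((M + N - n + 1).toNat : ℤ) := by omega
  rw [coeff_add, coeff_deriv, coeff_mul_eq_sum hM hN le_rfl hK,
    coeff_mul_eq_sum (hM.deriv v) hN le_rfl hK, coeff_mul_eq_sum hM (hN.deriv v) le_rfl hK,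
    pd_sum, ← Finset.sum_add_distrib]
  exact Finset.sum_congr rfl fun p _ => by
    rw [pd_zsmul, pd_mul, smul_add, pd_iterate_pd, coeff_deriv, coeff_deriv]

/-! #### The differential part -/

lemma pos_add_neg (P : PDO R) : P.pos + P.neg = P := by
  ext1; funext i
  change (if 0 ≤ i then P.coeff i else 0) + (if i < 0 then P.coeff i else 0) = P.coeff i
  rcases lt_or_ge i 0 with h | h
  · rw [if_neg (by omega), if_pos h, zero_add]
  · rw [if_pos h, if_neg (by omega), add_zero]

lemma neg_eq_self {P : PDO R} (h : P.OrdLE (-1)) : P.neg = P := by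
  ext1; funext i
  exact ite_eq_left_iff.2 fun hi => (h i (by omega)).symm

lemma neg_add_eq (P Q : PDO R) : (P + Q).neg = P.neg + Q.neg := by
  ext1; funext i
  change (if i < 0 then P.coeff i + Q.coeff i else 0) =
    (if i < 0 then P.coeff i else 0) + (if i < 0 then Q.coeff i else 0)
  split_ifs <;> simp

lemma neg_eq_of_coeff {P Q : PDO R} (hQ : Q.OrdLE (-1))
    (h : ∀ j : ℕ, P.coeff (-1 - j) = Q.coeff (-1 - j)) : P.neg = Q := by
  ext1; funext i
  change (if i < 0 then P.coeff i else 0) = Q.coeff i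
  split_ifs with hi
  · obtain ⟨j, rfl⟩ : ∃ j : ℕ, i = -1 - j := ⟨(-1 - i).toNat, by omega⟩
    exact h j
  · exact (hQ i (by omega)).symm

lemma act_eq_sum {P : PDO R} {N : ℤ} {K : ℕ} (hP : P.OrdLE N) (hK : N < K) (f : Fn R) :
    P.act f = ∑ i ∈ Finset.range K, P.coeff i * (pd x)^[i] f := by
  refine finsum_eq_sum_of_support_subset _ fun l hl => ?_
  rw [Function.mem_support] at hl
  rw [Finset.coe_range, Set.mem_Iio]
  by_contra h
  exact hl (by rw [hP _ (by omega), zero_mul])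

/-- If the residues of `∂^i X` are the derivatives of `f`, then the residue of `P X` is `P f` for
every differential operator `P`. -/
lemma coeff_neg_one_pos_mul {X : PDO R} {f : Fn R}
    (h : ∀ i : ℕ, (monomial i 1 * X).coeff (-1) = (pd x)^[i] f) (P : PDO R) :
    (P.pos * X).coeff (-1) = P.pos.act f := by
  obtain ⟨N, hN⟩ := P.exists_ordLE
  have hN' : P.pos.OrdLE N := fun i hi => by simp [pos, hN i hi]
  have hK : N < ((N + 1).toNat : ℕ) := by omega
  have hsum : P.pos = ∑ i ∈ Finset.range (N + 1).toNat, ofFn (P.pos.coeff i) * monomial i 1 := by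
    ext1; funext j
    change _ = coeffHom j _
    rw [map_sum]
    simp only [ofFn_mul_monomial_one]
    change _ = ∑ i ∈ _, (monomial _ _).coeff j
    rcases lt_or_ge j 0 with hj | hj
    · rw [Finset.sum_eq_zero fun i _ => coeff_monomial_of_ne (by omega) _]
      exact if_neg (by omega)
    · lift j to ℕ using hj
      by_cases hjN : (j : ℤ) ≤ N
      · rw [Finset.sum_eq_single j]
        · rw [coeff_monomial_self]
        · intro i _ hi
          exact coeff_monomial_of_ne (by omega) _
        · intro hj
          exact absurd (Finset.mem_range.2 (by omega)) hj
      · rw [hN' _ (by omega), Finset.sum_eq_zero]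
        intro i hi
        rw [Finset.mem_range] at hi
        exact coeff_monomial_of_ne (by omega) _
  rw [act_eq_sum hN' hK]
  nth_rw 1 [hsum]
  rw [Finset.sum_mul]
  change coeffHom (-1) _ = _
  rw [map_sum]
  refine Finset.sum_congr rfl fun i _ => ?_
  change (_ * _ * X).coeff (-1) = _
  rw [mul_assoc, coeff_ofFn_mul, h]

end PDO

/-! ### Chain rule for substitution, and coefficients in `λ`. -/

section Substitution

variable {σ τ S : Type*} [CommRing S]

lemma continuous_pderiv [TopologicalSpace S] [DiscreteTopology S] (v : σ) :
    open WithPiTopology in Continuous (fun f : MvPowerSeries σ S => pderiv S v f) := by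
  open WithPiTopology in
  refine continuous_pi fun d => ?_
  change Continuous fun f : MvPowerSeries σ S => coeff d (pderiv S v f)
  simp only [coeff_pderiv]
  exact (continuous_of_discreteTopology (f := fun c : S => c * (d v + 1))).comp
    (WithPiTopology.continuous_coeff S _)

/-- The chain rule for partial derivatives, when only finitely many of the substituted series
depend on the variable. -/
theorem pderiv_subst {a : σ → MvPowerSeries τ S} (ha : HasSubst a) (v : τ) (s : Finset σ)
    (hs : ∀ w, w ∉ s → pderiv S v (a w) = 0) (f : MvPowerSeries σ S) :
    pderiv S v (subst a f) = ∑ w ∈ s, subst a (pderiv S w f) * pderiv S v (a w) := by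
  have h0 : subst a (0 : MvPowerSeries σ S) = 0 := by rw [← coe_substAlgHom ha, map_zero]
  have h1 : subst a (1 : MvPowerSeries σ S) = 1 := by rw [← coe_substAlgHom ha, map_one]
  have hX : ∀ w, ∑ u ∈ s, subst a (pderiv S u (X w)) * pderiv S v (a u) = pderiv S v (a w) := by
    intro w
    by_cases hw : w ∈ s
    · rw [Finset.sum_eq_single w]
      · rw [pderiv_X_self, h1, one_mul]
      · intro u _ hu
        rw [pderiv_X_of_ne hu.symm, h0, zero_mul]
      · exact fun h => absurd hw h
    · rw [hs w hw, Finset.sum_eq_zero]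
      intro u hu
      rw [pderiv_X_of_ne (by rintro rfl; exact hw hu), h0, zero_mul]
  have key : ∀ p : MvPolynomial σ S, pderiv S v (subst a (p : MvPowerSeries σ S)) =
      ∑ w ∈ s, subst a (pderiv S w (p : MvPowerSeries σ S)) * pderiv S v (a w) := by
    intro p
    induction p using MvPolynomial.induction_on with
    | C c =>
      rw [MvPolynomial.coe_C, subst_C, pderiv_C, Finset.sum_eq_zero]
      intro w _
      rw [pderiv_C, h0, zero_mul]
    | add p q hp hq =>
      simp only [MvPolynomial.coe_add, subst_add ha, map_add, hp, hq, add_mul,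
        Finset.sum_add_distrib]
    | mul_X p w hp =>
      rw [MvPolynomial.coe_mul, subst_mul ha, Derivation.leibniz, MvPolynomial.coe_X, subst_X ha,
        ← hX, hp, smul_eq_mul, smul_eq_mul, Finset.mul_sum, Finset.mul_sum,
        ← Finset.sum_add_distrib]
      refine Finset.sum_congr rfl fun u _ => ?_
      rw [Derivation.leibniz, smul_eq_mul, smul_eq_mul, subst_add ha, subst_mul ha, subst_mul ha,
        subst_X ha]
      ring
  -- Polynomials are dense for the coefficientwise topology over discrete `S`, and both sides are
  -- continuous there.
  open WithPiTopology in
  let : UniformSpace S := ⊥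
  have : DiscreteUniformity S := ⟨rfl⟩
  refine congrFun (DenseRange.equalizer (denseRange_toMvPowerSeries (R := S) (σ := σ))
    (g := fun f => pderiv S v (subst a f))
    (h := fun f => ∑ w ∈ s, subst a (pderiv S w f) * pderiv S v (a w))
    ((continuous_pderiv v).comp (continuous_subst ha))
    (continuous_finsetSum s fun w _ =>
      ((continuous_subst ha).comp (continuous_pderiv w)).mul continuous_const) ?_) f
  funext p
  exact key p

/-- A family which consists of variables up to finitely many members can be substituted. -/
lemma hasSubst_of_eq_X {a : σ → MvPowerSeries τ S} {F : Set σ} (hF : F.Finite)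
    (h0 : ∀ w ∈ F, constantCoeff (a w) = 0) (u : σ → τ) (h : ∀ w, w ∉ F → a w = X (u w))
    (hu : ∀ v, (u ⁻¹' {v}).Finite) : HasSubst a where
  const_coeff w := by
    by_cases hw : w ∈ F
    · rw [h0 w hw]; exact IsNilpotent.zero
    · rw [h w hw, constantCoeff_X]; exact IsNilpotent.zero
  coeff_zero d := by
    classical
    refine (hF.union (d.support.finite_toSet.biUnion fun v _ => hu v)).subset fun w hw => ?_
    by_cases hwF : w ∈ F
    · exact Or.inl hwF
    · right
      rw [Set.mem_ofPred_eq, h w hwF, coeff_X] at hw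
      have hd : d = Finsupp.single (u w) 1 := by
        by_contra hne
        exact hw (if_neg hne)
      simp only [Set.mem_iUnion]
      exact ⟨u w, by simp [hd], rfl⟩

variable {R : Type*} [CommRing R]

/-- The coefficient of `(λ⁻¹)^m`, taken coefficientwise. -/
def lamCoeff (m : ℤ) : MvPowerSeries σ (LaurentSeries R) →+ MvPowerSeries σ R where
  toFun f := fun d => (coeff d f).coeff m
  map_zero' := by ext d; rfl
  map_add' f g := by ext d; rfl

lemma coeff_lamCoeff (m : ℤ) (f : MvPowerSeries σ (LaurentSeries R)) (d : σ →₀ ℕ) :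
    coeff d (lamCoeff m f) = (coeff d f).coeff m := rfl

lemma pderiv_lamCoeff (m : ℤ) (v : σ) (f : MvPowerSeries σ (LaurentSeries R)) :
    pderiv R v (lamCoeff m f) = lamCoeff m (pderiv (LaurentSeries R) v f) := by
  ext d
  have h : ∀ (S : Type _) [CommRing S] (c : S), c * ((d v : S) + 1) = (d v + 1) • c :=
    fun S _ c => by rw [nsmul_eq_mul]; push_cast; ring
  rw [coeff_pderiv, coeff_lamCoeff, coeff_lamCoeff, coeff_pderiv, h, h]
  rfl

/-- The substituted series do not involve `λ`, so they act on Laurent coefficients through scalars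
of `R`. -/
lemma lamCoeff_subst (m : ℤ) {a : σ → MvPowerSeries τ R} (ha : HasSubst a)
    (f : MvPowerSeries σ (LaurentSeries R)) :
    lamCoeff m (subst (fun w => map HahnSeries.C (a w) : σ → MvPowerSeries τ (LaurentSeries R)) f)
      = subst a (lamCoeff m f) := by
  have ha' : HasSubst (fun w => map HahnSeries.C (a w) : σ → MvPowerSeries τ (LaurentSeries R)) :=
    ha.map _
  ext e
  let φ : LaurentSeries R →+ R := ⟨⟨fun g => g.coeff m, rfl⟩, fun _ _ => rfl⟩
  rw [coeff_lamCoeff, coeff_subst ha', coeff_subst ha]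
  change φ _ = _
  rw [φ.map_finsum (coeff_subst_finite ha' f e)]
  refine finsum_congr fun d => ?_
  have h : (d.prod fun s n => (map HahnSeries.C (a s) : MvPowerSeries τ (LaurentSeries R)) ^ n) =
      map HahnSeries.C (d.prod fun s n => a s ^ n) := by
    simp [Finsupp.prod]
  rw [h, coeff_map, smul_eq_mul, mul_comm, HahnSeries.C_mul_eq_smul, smul_eq_mul, mul_comm]
  rfl

end Substitution

/-! ### The shifts `z - t̄_k`, `z - t̄_k'` and restriction to the diagonal. -/

section Wave

variable {R : Type*} [CommRing R]

/-- The variables of `f(z - t̄_k, t)`. -/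
def shiftVar (k : OddNat) : Var → Fn2 R
  | .z => X .z - X (.t k)
  | .t n => X (.t n)

/-- The variables of `f(z - t̄_k', t')`. -/
def shiftVar' (k : OddNat) : Var → Fn2 R
  | .z => X .z - X (.t' k)
  | .t n => X (.t' n)

/-- The values `z + t̄_k, t, t` of the variables `z, t, t'` which undo both shifts. -/
def diagVar (k : OddNat) : Var2 → Fn R
  | .z => X .z + X (.t k)
  | .t n => X (.t n)
  | .t' n => X (.t n)

/-- The restriction `f(z + t̄_k, t, t)` to the diagonal. -/
def diag (k : OddNat) (f : Fn2 R) : Fn R := subst (diagVar k) f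

lemma hasSubst_shiftVar (k : OddNat) : HasSubst (shiftVar k : Var → Fn2 R) := by
  let u : Var → Var2 := fun | .z => .z | .t n => .t n
  refine hasSubst_of_eq_X (Set.finite_singleton Var.z) (by rintro w rfl; simp [shiftVar]) u ?_
    fun v => Set.Subsingleton.finite ?_
  · rintro (_ | n) h
    exacts [absurd rfl h, rfl]
  · rintro (_ | n) rfl (_ | m) h <;> simp_all [u]

lemma hasSubst_shiftVar' (k : OddNat) : HasSubst (shiftVar' k : Var → Fn2 R) := by
  let u : Var → Var2 := fun | .z => .z | .t n => .t' n
  refine hasSubst_of_eq_X (Set.finite_singleton Var.z) (by rintro w rfl; simp [shiftVar']) u ?_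
    fun v => Set.Subsingleton.finite ?_
  · rintro (_ | n) h
    exacts [absurd rfl h, rfl]
  · rintro (_ | n) rfl (_ | m) h <;> simp_all [u]

lemma hasSubst_diagVar (k : OddNat) : HasSubst (diagVar k : Var2 → Fn R) := by
  let u : Var2 → Var := fun | .z => .z | .t n => .t n | .t' n => .t n
  refine hasSubst_of_eq_X (Set.finite_singleton Var2.z) (by rintro w rfl; simp [diagVar]) u ?_ ?_
  · rintro (_ | n | n) h
    exacts [absurd rfl h, rfl, rfl]
  · rintro (_ | m)
    · exact (Set.finite_singleton Var2.z).subset (by rintro (_ | n | n) h <;> simp_all [u])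
    · exact (Set.toFinite {Var2.t m, Var2.t' m}).subset
        (by rintro (_ | n | n) h <;> simp_all [u])

lemma shift_eq_subst (k : OddNat) (f : Fn R) : shift k f = subst (shiftVar k : Var → Fn2 R) f := by
  rw [shift]
  congr 1

lemma shift'_eq_subst (k : OddNat) (f : Fn R) :
    shift' k f = subst (shiftVar' k : Var → Fn2 R) f := by
  rw [shift']
  congr 1

lemma shift_sub (k : OddNat) (f g : Fn R) : shift k (f - g) = shift k f - shift k g := by
  simp only [shift_eq_subst, subst_sub (hasSubst_shiftVar k)]

lemma diag_shift (k : OddNat) (f : Fn R) : diag k (shift k f) = f := by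
  rw [diag, shift_eq_subst, subst_comp_subst_apply (hasSubst_shiftVar k) (hasSubst_diagVar k)]
  have : (fun s => subst (diagVar k) (shiftVar k s : Fn2 R)) = (X : Var → Fn R) := by
    funext v
    cases v <;> simp [shiftVar, subst_sub (hasSubst_diagVar k), subst_X (hasSubst_diagVar k),
      diagVar]
  rw [this, subst_self, id]

lemma diag_shift' (k : OddNat) (f : Fn R) : diag k (shift' k f) = f := by
  rw [diag, shift'_eq_subst, subst_comp_subst_apply (hasSubst_shiftVar' k) (hasSubst_diagVar k)]
  have : (fun s => subst (diagVar k) (shiftVar' k s : Fn2 R)) = (X : Var → Fn R) := by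
    funext v
    cases v <;> simp [shiftVar', subst_sub (hasSubst_diagVar k), subst_X (hasSubst_diagVar k),
      diagVar]
  rw [this, subst_self, id]

lemma diag_mul (k : OddNat) (f g : Fn2 R) : diag k (f * g) = diag k f * diag k g :=
  subst_mul (hasSubst_diagVar k) f g

lemma diag_sub (k : OddNat) (f g : Fn2 R) : diag k (f - g) = diag k f - diag k g :=
  subst_sub (hasSubst_diagVar k) f g

lemma diag_C (k : OddNat) (c : R) : diag k (C c : Fn2 R) = C c := subst_C c

lemma diag_resLam (k : OddNat) (f : Fn2 (LaurentSeries R)) :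
    diag k (resLam f) = lamCoeff 1 (diag k f) := by
  rw [diag, diag]
  have : (diagVar k : Var2 → Fn (LaurentSeries R)) =
      fun w => map HahnSeries.C (diagVar k w : Fn R) := by
    funext w
    cases w <;> simp [diagVar]
  rw [this, lamCoeff_subst _ (hasSubst_diagVar k)]
  rfl

lemma pderiv_t_shift_of_ne {k n : OddNat} (h : n ≠ k) (f : Fn R) :
    pderiv R (Var2.t n) (shift k f) = shift k (pd (.t n) f) := by
  rw [shift_eq_subst, shift_eq_subst, pderiv_subst (hasSubst_shiftVar k) _ {Var.t n}]
  · simp [shiftVar, pd]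
  · rintro (_ | m) hm
    · rw [shiftVar, map_sub, pderiv_X_of_ne (by simp), pderiv_X_of_ne (by simpa using h.symm),
        sub_zero]
    · exact pderiv_X_of_ne fun h => hm (by simpa using h)

/-- The inner derivative of `z - t̄_k` contributes `-∂_z`. This is how `w_z`, and through it `q` and
`r`, enters the flow of `t̄_k`. -/
lemma pderiv_t_shift_self (k : OddNat) (f : Fn R) :
    pderiv R (Var2.t k) (shift k f) = shift k (pd (.t k) f - pd .z f) := by
  classical
  rw [shift_sub]
  simp only [shift_eq_subst]
  rw [pderiv_subst (hasSubst_shiftVar k) _ {Var.t k, Var.z}, Finset.sum_pair (by simp)]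
  · simp [shiftVar, pd, pderiv_X_of_ne, sub_eq_add_neg]
  · rintro (_ | m) hm
    · simp at hm
    · exact pderiv_X_of_ne fun h => hm (by simpa using h)

lemma pderiv_t'_shift (k n : OddNat) (f : Fn R) : pderiv R (Var2.t' n) (shift k f) = 0 := by
  rw [shift_eq_subst, pderiv_subst (hasSubst_shiftVar k) _ ∅, Finset.sum_empty]
  rintro (_ | m) _ <;> simp [shiftVar, pderiv_X_of_ne]

lemma pderiv_t_shift' (k n : OddNat) (f : Fn R) : pderiv R (Var2.t n) (shift' k f) = 0 := by
  rw [shift'_eq_subst, pderiv_subst (hasSubst_shiftVar' k) _ ∅, Finset.sum_empty]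
  rintro (_ | m) _ <;> simp [shiftVar', pderiv_X_of_ne]

lemma pderiv_t'_shift'_of_ne {k n : OddNat} (h : n ≠ k) (f : Fn R) :
    pderiv R (Var2.t' n) (shift' k f) = shift' k (pd (.t n) f) := by
  rw [shift'_eq_subst, shift'_eq_subst, pderiv_subst (hasSubst_shiftVar' k) _ {Var.t n}]
  · simp [shiftVar', pd]
  · rintro (_ | m) hm
    · rw [shiftVar', map_sub, pderiv_X_of_ne (by simp), pderiv_X_of_ne (by simpa using h.symm),
        sub_zero]
    · exact pderiv_X_of_ne fun h => hm (by simpa using h)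

end Wave

/-! ### Residues in `λ` as residues of operators. -/

section Wave

variable {R : Type*} [CommRing R]

/-- The substitution `λ ↦ -λ` as a ring homomorphism. -/
def negLamHom : LaurentSeries R →+* LaurentSeries R where
  toFun := negLamCoeff
  map_one' := by
    ext n
    change (Int.negOnePow n : ℤ) • (1 : LaurentSeries R).coeff n = _
    by_cases h : n = 0
    · subst h; simp
    · rw [HahnSeries.coeff_one, if_neg h, smul_zero]
  map_mul' f g := by
    have hs : ∀ f : LaurentSeries R, (negLamCoeff f).support ⊆ f.support :=
      fun f n hn h => hn (by simp only [negLamCoeff, h, smul_zero])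
    ext n
    rw [HahnSeries.coeff_mul_left' f.isPWO_support (hs f)]
    change (Int.negOnePow n : ℤ) • (f * g).coeff n = _
    rw [HahnSeries.coeff_mul, Finset.smul_sum]
    -- The signs are units, so the support does not change and both convolution sums have the same
    -- index set.
    have hg : (negLamCoeff g).support = g.support := by
      refine (hs g).antisymm fun n hn h => hn ?_
      have h' : (Int.negOnePow n : ℤ) • ((Int.negOnePow n : ℤ) • g.coeff n) = 0 := by
        rw [show (Int.negOnePow n : ℤ) • g.coeff n = 0 from h, smul_zero]
      rwa [smul_smul, ← Units.val_mul, ← sq, Int.units_sq, Units.val_one, one_smul] at h'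
    simp only [hg]
    refine Finset.sum_congr rfl fun p hp => ?_
    obtain ⟨-, -, h⟩ := Finset.mem_antidiagonal.1 hp
    change _ = ((Int.negOnePow p.1 : ℤ) • f.coeff p.1) * ((Int.negOnePow p.2 : ℤ) • g.coeff p.2)
    rw [smul_mul_smul_comm, ← h, Int.negOnePow_add, Units.val_mul]
  map_zero' := by
    ext n
    exact smul_zero _
  map_add' f g := by
    ext n
    exact smul_add _ _ _

lemma coeff_negLamHom (f : LaurentSeries R) (n : ℤ) :
    (negLamHom f).coeff n = (Int.negOnePow n : ℤ) • f.coeff n := rfl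

lemma negLam_eq_map (f : Fn (LaurentSeries R)) : negLam f = map negLamHom f := rfl

lemma negLam_mul (f g : Fn (LaurentSeries R)) : negLam (f * g) = negLam f * negLam g := by
  simp only [negLam_eq_map, map_mul]

lemma negLam_lam (n : ℤ) : negLamHom (lam n : LaurentSeries R) = (n.negOnePow : ℤ) • lam n := by
  ext m
  rw [coeff_negLamHom, HahnSeries.coeff_smul, lam, HahnSeries.coeff_single]
  split_ifs with h
  · rw [h, Int.negOnePow_neg]
  · rw [smul_zero, smul_zero]

lemma pd_negLam (v : Var) (f : Fn (LaurentSeries R)) : pd v (negLam f) = negLam (pd v f) := by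
  ext1 d
  rw [negLam_eq_map, negLam_eq_map, pd, pd, coeff_pderiv, coeff_map, coeff_map, coeff_pderiv,
    map_mul, map_add, map_natCast, map_one]

lemma coeff_symbol (P : PDO R) (d : Var →₀ ℕ) (n : ℤ) :
    (coeff d (symbol P)).coeff n = coeff d (P.coeff (-n)) := rfl

/-- The symbol as an additive map. -/
def symbolHom : PDO R →+ Fn (LaurentSeries R) where
  toFun := symbol
  map_zero' := by
    ext d n
    rw [coeff_symbol]
    rfl
  map_add' P Q := by
    ext d n
    rw [coeff_symbol]
    rfl

lemma symbol_add (P Q : PDO R) : symbol (P + Q) = symbol P + symbol Q := symbolHom.map_add P Q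

lemma symbol_mul_monomial_one (P : PDO R) (n : ℤ) :
    symbol (P * PDO.monomial n 1) = C (lam n) * symbol P := by
  ext d m
  rw [coeff_symbol, PDO.coeff_mul_monomial_one, coeff_C_mul, lam, HahnSeries.coeff_single_mul,
    one_mul, coeff_symbol]
  congr 2
  ring

lemma pd_symbol (v : Var) (P : PDO R) : pd v (symbol P) = symbol (P.deriv v) := by
  ext d m
  have h : ∀ (S : Type _) [CommRing S] (c : S), c * ((d v : S) + 1) = (d v + 1) • c :=
    fun S _ c => by rw [nsmul_eq_mul]; push_cast; ring
  rw [coeff_symbol, PDO.coeff_deriv, pd, pd, coeff_pderiv, coeff_pderiv, h, h]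
  rfl

lemma coeff_symbol_monomial (i : ℤ) (a : Fn R) (d : Var →₀ ℕ) :
    coeff d (symbol (PDO.monomial i a)) = HahnSeries.single (-i) (coeff d a) := by
  ext n
  rw [coeff_symbol, PDO.coeff_monomial, HahnSeries.coeff_single]
  by_cases h : n = -i
  · rw [if_pos (by omega), if_pos h]
  · rw [if_neg (by omega), if_neg h, map_zero]

/-- The residue of `P(λ) Q(-λ)` vanishes for operators of small order. -/
lemma lamCoeff_one_symbol_mul_negLam_of_ordLE {P Q : PDO R} {M N : ℤ} (hP : P.OrdLE M)
    (hQ : Q.OrdLE N) (h : M + N < -1) : lamCoeff 1 (symbol P * negLam (symbol Q)) = 0 := by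
  classical
  ext d
  rw [coeff_lamCoeff, coeff_mul]
  change HahnSeries.coeff.addMonoidHom (1 : ℤ) _ = _
  rw [map_sum, map_zero, Finset.sum_eq_zero]
  intro p _
  change (coeff p.1 (symbol P) * coeff p.2 (negLam (symbol Q))).coeff 1 = 0
  rw [HahnSeries.coeff_mul, Finset.sum_eq_zero]
  intro q hq
  obtain ⟨-, -, hq⟩ := Finset.mem_antidiagonal.1 hq
  rw [negLam_eq_map, coeff_map, coeff_negLamHom, coeff_symbol, coeff_symbol]
  by_cases h1 : M < -q.1
  · rw [hP _ h1, map_zero, zero_mul]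
  · rw [hQ _ (by omega), map_zero, smul_zero, mul_zero]

/-- The residue in `λ` of `P(λ) Q(-λ)` is the residue of the operator `P Q^*`. -/
theorem lamCoeff_one_symbol_mul_negLam (P Q : PDO R) :
    lamCoeff 1 (symbol P * negLam (symbol Q)) = (P * Q.adjoint).coeff (-1) := by
  classical
  let negLamAdd : Fn (LaurentSeries R) →+ Fn (LaurentSeries R) :=
    (map negLamHom : Fn (LaurentSeries R) →+* Fn (LaurentSeries R)).toAddMonoidHom
  obtain ⟨N, hN⟩ := Q.exists_ordLE
  -- Both sides are biadditive and vanish once the orders of `P` and `Q` add up to at most `-2`, so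
  -- first `P` and then `Q` may be taken to be a monomial.
  refine PDO.addHom_eq_of_monomial
    ((lamCoeff 1).comp ((AddMonoidHom.mulRight (negLam (symbol Q))).comp symbolHom))
    ((PDO.coeffHom (-1)).comp (PDO.mulHom.flip Q.adjoint)) ?_ ?_ ?_ P
  · exact ⟨-2 - N, fun P hP => lamCoeff_one_symbol_mul_negLam_of_ordLE hP hN (by omega)⟩
  · exact ⟨-2 - N, fun P hP => (hP.mul hN.adjoint) _ (by omega)⟩
  intro i a
  refine PDO.addHom_eq_of_monomial
    ((lamCoeff 1).comp ((AddMonoidHom.mulLeft (symbol (PDO.monomial i a))).comp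
      (negLamAdd.comp symbolHom)))
    ((PDO.coeffHom (-1)).comp ((PDO.mulHom (PDO.monomial i a)).comp PDO.adjointHom)) ?_ ?_ ?_ Q
  · exact ⟨-2 - i, fun Q hQ =>
      lamCoeff_one_symbol_mul_negLam_of_ordLE (PDO.ordLE_monomial i a) hQ (by omega)⟩
  · exact ⟨-2 - i, fun Q hQ => ((PDO.ordLE_monomial i a).mul hQ.adjoint) _ (by omega)⟩
  intro j b
  change lamCoeff 1 (symbol (PDO.monomial i a) * negLam (symbol (PDO.monomial j b))) =
    (PDO.monomial i a * (PDO.monomial j b).adjoint).coeff (-1)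
  rw [PDO.coeff_neg_one_monomial_mul_adjoint]
  have key : ∀ r s : R, (HahnSeries.single (-i) r *
      negLamHom (HahnSeries.single (-j) s : LaurentSeries R)).coeff 1 =
      if i + j = -1 then (j.negOnePow : ℤ) • (r * s) else 0 := by
    intro r s
    rw [HahnSeries.coeff_single_mul, coeff_negLamHom, HahnSeries.coeff_single]
    by_cases h : i + j = -1
    · rw [if_pos (by omega), if_pos h, show (1 : ℤ) - -i = -j by omega, Int.negOnePow_neg,
        mul_smul_comm]
    · rw [if_neg (by omega), if_neg h, smul_zero, mul_zero]
  ext d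
  rw [coeff_lamCoeff, coeff_mul]
  change HahnSeries.coeff.addMonoidHom (1 : ℤ) _ = _
  rw [map_sum]
  have h1 : ∀ p ∈ Finset.HasAntidiagonal.antidiagonal d, HahnSeries.coeff.addMonoidHom (1 : ℤ)
      (coeff p.1 (symbol (PDO.monomial i a)) * coeff p.2 (negLam (symbol (PDO.monomial j b)))) =
      if i + j = -1 then (j.negOnePow : ℤ) • (coeff p.1 a * coeff p.2 b) else 0 := by
    intro p _
    rw [negLam_eq_map, coeff_map, coeff_symbol_monomial, coeff_symbol_monomial]
    exact key _ _
  rw [Finset.sum_congr rfl h1]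
  split_ifs
  · rw [← Finset.smul_sum, ← coeff_mul, map_zsmul]
  · rw [Finset.sum_const_zero, map_zero]

lemma partialX_mul_eq (P : PDO R) :
    PDO.partialX * P = P.deriv x + P * PDO.partialX := by
  ext1; funext n
  rw [PDO.coeff_partialX_mul, PDO.coeff_add, PDO.partialX, PDO.coeff_mul_monomial_one,
    PDO.coeff_deriv]

/-! ### The exponential -/

lemma coeff_xi_single (n : OddNat) :
    coeff (Finsupp.single (Var.t n) 1) (xi : Fn (LaurentSeries R)) = lam (n.1 : ℤ) := by
  classical
  change ∑ᶠ m : OddNat, _ = _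
  rw [finsum_eq_single _ n]
  · rw [coeff_C_mul, coeff_X, if_pos rfl, mul_one]
  · intro m hm
    rw [coeff_C_mul, coeff_X, if_neg, mul_zero]
    intro h
    have := (Finsupp.single_left_inj one_ne_zero).1 h
    exact hm (by simpa using this.symm)

lemma coeff_xi_of_forall_ne {d : Var →₀ ℕ} (h : ∀ n, d ≠ Finsupp.single (Var.t n) 1) :
    coeff d (xi : Fn (LaurentSeries R)) = 0 := by
  classical
  change ∑ᶠ m : OddNat, _ = _
  rw [← finsum_zero (α := OddNat)]
  refine finsum_congr fun m => ?_
  rw [coeff_C_mul, coeff_X, if_neg (h m), mul_zero]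

lemma pd_z_xi : pd .z (xi : Fn (LaurentSeries R)) = 0 := by
  ext1 d
  rw [pd, coeff_pderiv, coeff_xi_of_forall_ne, zero_mul, map_zero]
  intro n h
  have := DFunLike.congr_fun h Var.z
  simp at this

lemma pd_t_xi (n : OddNat) : pd (.t n) (xi : Fn (LaurentSeries R)) = C (lam (n.1 : ℤ)) := by
  classical
  ext1 d
  rw [pd, coeff_pderiv, coeff_C]
  split_ifs with hd
  · rw [hd, zero_add, coeff_xi_single]
    simp
  · rw [coeff_xi_of_forall_ne, zero_mul]
    intro m h
    apply hd
    have hmn : m = n := by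
      by_contra hne
      have := DFunLike.congr_fun h (Var.t n)
      rw [Finsupp.add_apply, Finsupp.single_eq_same,
        Finsupp.single_eq_of_ne (by simpa using Ne.symm hne)] at this
      omega
    rw [hmn] at h
    exact add_eq_right.1 h

lemma constantCoeff_xi : constantCoeff (xi : Fn (LaurentSeries R)) = 0 := by
  rw [← coeff_zero_eq_constantCoeff_apply, coeff_xi_of_forall_ne]
  intro n h
  have := DFunLike.congr_fun h (Var.t n)
  simp at this

variable [Algebra ℚ R]

lemma pd_expXi (v : Var) :
    pd v (expXi : Fn (LaurentSeries R)) = expXi * pd v xi := by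
  have hxi : HasSubst (fun _ : Unit => (xi : Fn (LaurentSeries R))) :=
    (PowerSeries.HasSubst.of_constantCoeff_zero constantCoeff_xi).const
  have hexp : pderiv (LaurentSeries R) () (PowerSeries.exp (LaurentSeries R)) =
      PowerSeries.exp (LaurentSeries R) := by
    refine MvPowerSeries.ext fun d => ?_
    obtain ⟨m, rfl⟩ : ∃ m, d = Finsupp.single () m :=
      ⟨(d : Unit →₀ ℕ) (), Finsupp.unique_ext (by simp)⟩
    rw [coeff_pderiv, ← Finsupp.single_add]
    change PowerSeries.coeff (m + 1) (PowerSeries.exp _) * _ =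
      PowerSeries.coeff m (PowerSeries.exp _)
    rw [PowerSeries.coeff_exp, PowerSeries.coeff_exp, Finsupp.single_eq_same,
      show ((m : LaurentSeries R) + 1) = algebraMap ℚ _ ((m : ℚ) + 1) by simp, ← map_mul]
    congr 1
    rw [Nat.factorial_succ]
    have : (m.factorial : ℚ) ≠ 0 := by exact_mod_cast m.factorial_ne_zero
    push_cast
    field_simp
  have h := pderiv_subst hxi v {()} (fun w hw => absurd (Finset.mem_singleton.2 rfl) hw)
    (PowerSeries.exp (LaurentSeries R))
  rw [Finset.sum_singleton, hexp] at h
  exact h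

lemma constantCoeff_expXi : constantCoeff (expXi : Fn (LaurentSeries R)) = 1 := by
  rw [expXi, PowerSeries.constantCoeff_subst
    (PowerSeries.HasSubst.of_constantCoeff_zero constantCoeff_xi), finsum_eq_single _ 0]
  · simp
  · intro n hn
    rw [map_pow, constantCoeff_xi, zero_pow hn, smul_zero]

/-- Both sides have the same constant term and, as `ξ(t, -λ) = -ξ(t, λ)` for odd indices, the same
partial derivatives. Over a `ℚ`-algebra this determines a power series. -/
lemma expXi_mul_negLam_expXi : (expXi : Fn (LaurentSeries R)) * negLam expXi = 1 := by
  have : IsAddTorsionFree (LaurentSeries R) := IsAddTorsionFree.of_module_rat (LaurentSeries R)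
  refine pderiv.ext (fun v => ?_) ?_
  · change pd v _ = pd v _
    have hxi : negLam (pd v (xi : Fn (LaurentSeries R))) = -pd v xi := by
      cases v with
      | z => rw [pd_z_xi, negLam_eq_map, map_zero, neg_zero]
      | t n =>
        have hn : (n.1 : ℤ).negOnePow = -1 := Int.negOnePow_odd _ (by exact_mod_cast n.2)
        rw [pd_t_xi, negLam_eq_map, map_C, negLam_lam, hn]
        simp
    rw [pd_one, pd_mul, pd_negLam, pd_expXi, negLam_mul, hxi]
    ring
  · rw [map_mul, constantCoeff_expXi, one_mul, map_one, negLam_eq_map,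
      ← coeff_zero_eq_constantCoeff_apply, coeff_map, coeff_zero_eq_constantCoeff_apply,
      constantCoeff_expXi, map_one]

/-! ### Wave functions -/

/-- Differentiating `e^ξ` brings down `λ^n`, which on symbols is right multiplication by `∂^n`. -/
lemma pd_t_applyExp (n : OddNat) (P : PDO R) :
    pd (.t n) (applyExp P) = applyExp (P.deriv (.t n) + P * PDO.partialX ^ n.1) := by
  rw [applyExp, applyExp, pd_mul, pd_expXi, pd_t_xi, pd_symbol, symbol_add, PDO.partialX_pow,
    symbol_mul_monomial_one]
  ring

lemma pd_x_applyExp (P : PDO R) : pd x (applyExp P) = applyExp (PDO.partialX * P) := by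
  rw [partialX_mul_eq, x, pd_t_applyExp, pow_one]

/-- The residue of a product of wave functions is a residue of operators. -/
theorem lamCoeff_one_wave_mul_wave (P Q : PDO R) :
    lamCoeff 1 (C (lam (-1)) * applyExp P * negLam (applyExp Q)) =
      (P * PDO.partialXInv * Q.adjoint).coeff (-1) := by
  rw [← lamCoeff_one_symbol_mul_negLam, PDO.partialXInv, symbol_mul_monomial_one, applyExp,
    applyExp, negLam_mul]
  refine congrArg (lamCoeff 1) ?_
  calc _ = C (lam (-1)) * symbol P * negLam (symbol Q) * (expXi * negLam expXi) := by ring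
    _ = _ := by rw [expXi_mul_negLam_expXi, mul_one]

end Wave

/-! ### Dressing operators: inverses, Lax equation and adjoint. -/

namespace PDO

variable {R : Type*} [CommRing R]

lemma coeff_mul_of_ordLE {P Q : PDO R} {M N : ℤ} (hP : P.OrdLE M) (hQ : Q.OrdLE N) :
    (P * Q).coeff (M + N) = P.coeff M * Q.coeff N := by
  rw [coeff_mul_eq_sum hP hQ (m := M) (K := 1) (by omega) (by push_cast; omega)]
  simp

lemma coeff_ofFn_mul_partialXInv_mul_ofFn (a b : Fn R) (j : ℕ) :
    (ofFn a * partialXInv * ofFn b).coeff (-1 - j) = (-1) ^ j * (a * (pd x)^[j] b) := by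
  rw [mul_assoc, coeff_ofFn_mul, partialXInv, ofFn,
    coeff_monomial_mul (ordLE_monomial 0 b) (K := j + 1) (by push_cast; omega),
    Finset.sum_eq_single j]
  · rw [show (-1 - j - -1 + j : ℤ) = 0 by ring, coeff_monomial_self, choose_neg_one, zsmul_eq_mul]
    push_cast
    ring
  · intro l _ hl
    rw [coeff_monomial_of_ne (by omega), iterate_pd_zero, mul_zero, smul_zero]
  · exact fun h => absurd (Finset.mem_range.2 j.lt_succ_self) h

lemma ordLE_ghost (q r : Fn R) : (ghost q r).OrdLE (-1) := by
  have h : ∀ a b : Fn R, (ofFn a * partialXInv * ofFn b).OrdLE (-1) := fun a b =>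
    ((ordLE_monomial 0 a).mul (ordLE_monomial (-1) 1)).mul (ordLE_monomial 0 b)
  exact (h _ _).sub (h _ _)

/-- A right inverse of a dressing operator is a left inverse. -/
lemma mul_eq_one_of_isDressing {W V : PDO R} (hW : W.IsDressing) (hV : V.OrdLE 0)
    (h : W * V = 1) : V * W = 1 := by
  have hV0 : V.coeff 0 = 1 := by
    have := coeff_mul_of_ordLE hW.2 hV
    rw [h, add_zero, hW.1, one_mul] at this
    exact this.symm
  -- The defect `1 - V W` is an idempotent of order at most `-1`, hence equal to all its powers and
  -- of arbitrarily negative order.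
  have he : (1 - V * W) * (1 - V * W) = 1 - V * W := by
    have : V * W * (V * W) = V * W := by rw [mul_assoc, ← mul_assoc W, h, one_mul]
    rw [mul_sub, mul_one, sub_mul, one_mul, this, sub_self, sub_zero]
  have h1 : (1 - V * W).OrdLE (-1) := by
    intro i hi
    rcases eq_or_ne i 0 with rfl | hi0
    · have := coeff_mul_of_ordLE hV hW.2
      rw [add_zero, hV0, hW.1, one_mul] at this
      rw [coeff_sub, this, one_def, coeff_monomial_self, sub_self]
    · exact ((ordLE_monomial 0 1).sub (hV.mul hW.2)) i (by omega)
  have h2 : ∀ n : ℕ, (1 - V * W).OrdLE (-1 - n) := by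
    intro n
    induction n with
    | zero => simpa using h1
    | succ n ih =>
      rw [← he]
      exact (h1.mul ih).mono (by push_cast; omega)
  have h3 : 1 - V * W = 0 := by
    ext1; funext i
    exact h2 (-i).toNat i (by omega)
  exact (sub_eq_zero.1 h3).symm

section Dressing

variable {W V : PDO R}

lemma dressing_pow (hVW : V * W = 1) (hWV : W * V = 1) (n : ℕ) :
    (W * partialX * V) ^ n = W * partialX ^ n * V := by
  induction n with
  | zero =>
    rw [pow_zero, pow_zero, mul_one, hWV]
  | succ n ih =>
    rw [pow_succ, ih, pow_succ]
    simp only [mul_assoc]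
    rw [← mul_assoc V W, hVW, one_mul]

/-- The Sato equation implies the Lax equation. -/
lemma deriv_dressing (hVW : V * W = 1) (hWV : W * V = 1) (v : Var) (n : ℕ) {P : PDO R}
    (h : W.deriv v * V + (W * partialX * V) ^ n = P) :
    (W * partialX * V).deriv v = P.comm (W * partialX * V) := by
  set L := W * partialX * V with hL
  have h1 : W.deriv v * V = P - L ^ n := eq_sub_of_add_eq h
  have h2 : V.deriv v = -(V * (W.deriv v * V)) := by
    have h3 : W.deriv v * V + W * V.deriv v = 0 := by
      rw [← deriv_mul, hWV, one_def, deriv_monomial_one]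
    calc V.deriv v = V * (W * V.deriv v) := by rw [← mul_assoc, hVW, one_mul]
      _ = _ := by rw [eq_neg_of_add_eq_zero_right h3, mul_neg]
  have h4 : W.deriv v * partialX * V = W.deriv v * V * L := by
    rw [hL]
    simp only [mul_assoc]
    rw [← mul_assoc V W, hVW, one_mul]
  -- Conjugation gives `L_v = [W_v V, L]`, and replacing `W_v V` by `P - L^n` changes nothing
  -- because `L^n` commutes with `L`.
  have h5 : L ^ n * L = L * L ^ n := (Commute.pow_self L n).eq
  have h6 : (partialX : PDO R).deriv v = 0 := deriv_monomial_one v 1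
  rw [hL, deriv_mul, deriv_mul, h6, mul_zero, add_zero, h2, ← hL, h4, mul_neg,
    ← mul_assoc (W * partialX) V, ← hL, h1, comm, sub_mul, mul_sub, h5]
  abel

/-- As `W_x V` has order at most `-1`, this shows the shape `∂ + ∑ u_i ∂^{-i}` of `L`. -/
lemma dressing_eq_sub (hWV : W * V = 1) :
    W * partialX * V = partialX - W.deriv x * V := by
  have h : W * partialX = partialX * W - W.deriv x := by
    rw [partialX_mul_eq, add_sub_cancel_left]
  rw [h, sub_mul, mul_assoc, hWV, mul_one]

lemma ordLE_deriv_of_isDressing (hW : W.IsDressing) (v : Var) : (W.deriv v).OrdLE (-1) := by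
  intro i hi
  rcases eq_or_ne i 0 with rfl | hi0
  · rw [coeff_deriv, hW.1, pd_one]
  · rw [coeff_deriv, hW.2 i (by omega), pd_zero]

/-- Inverting the hypothesis gives `V^* = ∂ W ∂⁻¹`, and then `L^* = -V^* ∂ W^*` simplifies. -/
lemma adjoint_dressing (hWV : W * V = 1) (hVW : V * W = 1)
    (hW : W.adjoint = partialX * V * partialXInv) :
    (W * partialX * V).adjoint = -(partialX * (W * partialX * V) * partialXInv) := by
  have h1 : V.adjoint * W.adjoint = 1 := by rw [← adjoint_mul, hWV, adjoint_one]
  have h2 : W.adjoint * (partialX * W * partialXInv) = 1 := by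
    rw [hW]
    calc _ = partialX * (V * (partialXInv * partialX) * W) * partialXInv := by
          simp only [mul_assoc]
      _ = 1 := by rw [partialXInv_mul_partialX, mul_one, hVW, mul_one, partialX_mul_partialXInv]
  have h3 : V.adjoint = partialX * W * partialXInv := left_inv_eq_right_inv h1 h2
  rw [adjoint_mul, adjoint_mul, adjoint_partialX, h3, hW]
  calc _ = -(partialX * W * (partialXInv * partialX) * partialX * V * partialXInv) := by
        simp only [mul_assoc, neg_mul, mul_neg]
    _ = _ := by
      rw [partialXInv_mul_partialX, mul_one]
      simp only [mul_assoc]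

end Dressing

end PDO

/-! ### Consequences of a bilinear identity on the diagonal. -/

section Bilinear

variable {R : Type*} [CommRing R]

/-- The bilinear form `res λ⁻¹ f(z - t̄_k, t, λ) g(z - t̄_k', t', λ)`. -/
def bilin (k : OddNat) (f g : Fn (LaurentSeries R)) : Fn2 R :=
  resLam (C (lam (-1)) * shift k f * shift' k g)

lemma bilin_eq_lamCoeff (k : OddNat) (f g : Fn (LaurentSeries R)) :
    bilin k f g = lamCoeff 1 (C (lam (-1)) * shift k f * shift' k g) := rfl

lemma bilin_sub (k : OddNat) (f f' g : Fn (LaurentSeries R)) :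
    bilin k (f - f') g = bilin k f g - bilin k f' g := by
  rw [bilin_eq_lamCoeff, shift_sub, mul_sub, sub_mul, map_sub]
  rfl

lemma pderiv_t_bilin_of_ne {k n : OddNat} (h : n ≠ k) (f g : Fn (LaurentSeries R)) :
    pderiv R (Var2.t n) (bilin k f g) = bilin k (pd (.t n) f) g := by
  rw [bilin_eq_lamCoeff, pderiv_lamCoeff, Derivation.leibniz, Derivation.leibniz, pderiv_C,
    pderiv_t_shift', pderiv_t_shift_of_ne h, smul_zero, smul_zero, zero_add, add_zero, smul_eq_mul,
    smul_eq_mul, mul_comm]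
  rfl

lemma pderiv_t_bilin_self (k : OddNat) (f g : Fn (LaurentSeries R)) :
    pderiv R (Var2.t k) (bilin k f g) = bilin k (pd (.t k) f) g - bilin k (pd .z f) g := by
  rw [← bilin_sub, bilin_eq_lamCoeff, pderiv_lamCoeff, Derivation.leibniz, Derivation.leibniz,
    pderiv_C, pderiv_t_shift', pderiv_t_shift_self, smul_zero, smul_zero, zero_add, add_zero,
    smul_eq_mul, smul_eq_mul, mul_comm]
  rfl

lemma pderiv_t'_bilin_of_ne {k n : OddNat} (h : n ≠ k) (f g : Fn (LaurentSeries R)) :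
    pderiv R (Var2.t' n) (bilin k f g) = bilin k f (pd (.t n) g) := by
  rw [bilin_eq_lamCoeff, pderiv_lamCoeff, Derivation.leibniz, Derivation.leibniz, pderiv_C,
    pderiv_t'_shift'_of_ne h, pderiv_t'_shift, smul_zero, smul_zero, zero_add, smul_zero,
    add_zero, smul_eq_mul]
  rfl

lemma diag_bilin (k : OddNat) (f g : Fn (LaurentSeries R)) :
    diag k (bilin k f g) = lamCoeff 1 (C (lam (-1)) * f * g) := by
  rw [bilin, diag_resLam, diag_mul, diag_mul, diag_C, diag_shift, diag_shift']

variable [Algebra ℚ R] {k : OddNat}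

lemma diag_bilin_wave (P Q : PDO R) :
    diag k (bilin k (applyExp P) (negLam (applyExp Q))) =
      (P * PDO.partialXInv * Q.adjoint).coeff (-1) := by
  rw [diag_bilin, lamCoeff_one_wave_mul_wave]

/-- A bilinear identity `res λ⁻¹ P(e^ξ) Q(e^ξ') = a b' - c d'` determines the negative part of
`P ∂⁻¹ Q^*`. -/
theorem coeff_of_bilin_wave (hk : k.1 ≠ 1) {P Q : PDO R} {a b c d : Fn R}
    (h : bilin k (applyExp P) (negLam (applyExp Q)) =
      shift k a * shift' k b - shift k c * shift' k d) (j : ℕ) :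
    (P * PDO.partialXInv * Q.adjoint).coeff (-1 - j) =
      (-1) ^ j * (a * (pd x)^[j] b - c * (pd x)^[j] d) := by
  have hk' : (⟨1, odd_one⟩ : OddNat) ≠ k := fun h => hk (by rw [← h])
  -- Each derivative in `t₁'` multiplies `Q` by `∂` on the left and falls only on the primed
  -- functions `b` and `d`.
  have h1 : bilin k (applyExp P) (negLam (applyExp (PDO.monomial j 1 * Q))) =
      shift k a * shift' k ((pd x)^[j] b) - shift k c * shift' k ((pd x)^[j] d) := by
    induction j with
    | zero =>
      change _ = shift k a * shift' k b - shift k c * shift' k d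
      rw [← h, Nat.cast_zero, ← PDO.one_def, one_mul]
    | succ j ih =>
      have h2 := congrArg (pderiv R (Var2.t' ⟨1, odd_one⟩)) ih
      rw [pderiv_t'_bilin_of_ne hk', map_sub, Derivation.leibniz, Derivation.leibniz,
        pderiv_t'_shift, pderiv_t'_shift, smul_zero, smul_zero, add_zero, add_zero,
        pderiv_t'_shift'_of_ne hk', pderiv_t'_shift'_of_ne hk', smul_eq_mul, smul_eq_mul,
        pd_negLam] at h2
      change bilin k _ (negLam (pd x _)) = _ at h2
      rw [pd_x_applyExp, ← mul_assoc, PDO.partialX_mul_monomial_one] at h2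
      rw [Function.iterate_succ_apply', Function.iterate_succ_apply']
      exact h2
  -- Since `(∂^j Q)^* = (-1)^j Q^* ∂^j`, the residue on the diagonal is, up to this sign, the
  -- coefficient of `∂^(-1-j)`.
  have h2 := congrArg (diag k) h1
  rw [diag_bilin_wave, diag_sub, diag_mul, diag_mul, diag_shift, diag_shift, diag_shift',
    diag_shift', PDO.adjoint_mul, PDO.adjoint_monomial] at h2
  change (_ * (_ * (_ • (_ * (1 : PDO R))))).coeff (-1) = _ at h2
  rw [mul_one, mul_smul_comm, mul_smul_comm, PDO.coeff_zsmul, ← mul_assoc,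
    PDO.coeff_mul_monomial_one] at h2
  have hs : ((j : ℤ).negOnePow : ℤ) = (-1) ^ j := by
    rw [Int.negOnePow_def]; simp
  rw [← h2, hs, zsmul_eq_mul, ← mul_assoc]
  push_cast
  rw [← mul_pow]
  simp

/-- The residues which express the derivatives of `f` in terms of wave functions. -/
lemma coeff_neg_one_of_bilin_wave (hk : k.1 ≠ 1) {P Q : PDO R} {f : Fn R}
    (h : shift k f = bilin k (applyExp P) (negLam (applyExp Q))) (i : ℕ) :
    (PDO.monomial i 1 * (P * PDO.partialXInv * Q.adjoint)).coeff (-1) = (pd x)^[i] f := by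
  have hk' : (⟨1, odd_one⟩ : OddNat) ≠ k := fun h => hk (by rw [← h])
  have h1 : shift k ((pd x)^[i] f) =
      bilin k (applyExp (PDO.monomial i 1 * P)) (negLam (applyExp Q)) := by
    induction i with
    | zero =>
      change shift k f = _
      rw [h, Nat.cast_zero, ← PDO.one_def, one_mul]
    | succ i ih =>
      have h2 := congrArg (pderiv R (Var2.t ⟨1, odd_one⟩)) ih
      rw [pderiv_t_bilin_of_ne hk', pderiv_t_shift_of_ne hk'] at h2
      change _ = bilin k (pd x _) _ at h2
      rw [pd_x_applyExp, ← mul_assoc, PDO.partialX_mul_monomial_one] at h2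
      rw [Function.iterate_succ_apply']
      exact h2
  have h2 := congrArg (diag k) h1
  rw [diag_bilin_wave, diag_shift] at h2
  rw [h2]
  simp only [mul_assoc]

/-- The evolution of a function which is reproduced by the wave function. -/
lemma pd_eq_act_of_bilin_wave (hk : k.1 ≠ 1) {W Q B : PDO R} {f : Fn R} {n : OddNat}
    (hn : n ≠ k) (hB : W.deriv (.t n) + W * PDO.partialX ^ n.1 = B.pos * W)
    (h : shift k f = bilin k (applyExp W) (negLam (applyExp Q))) :
    pd (.t n) f = B.pos.act f := by
  -- The derivative in `t_n` turns `W` into `B.pos * W` inside the reproducing identity; the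
  -- function `Q(e^ξ)` of the primed times is not affected.
  have h1 := congrArg (fun g => diag k (pderiv R (Var2.t n) g)) h
  simp only [pderiv_t_bilin_of_ne hn, pderiv_t_shift_of_ne hn, pd_t_applyExp, diag_shift,
    diag_bilin_wave, hB] at h1
  rw [h1, ← PDO.coeff_neg_one_pos_mul (coeff_neg_one_of_bilin_wave hk h)]
  simp only [mul_assoc]

end Bilinear

end ExtBKP

end

/-! ### The extended BKP hierarchy. -/

open ExtBKP in
theorem mainTheorem3 {R : Type*} [CommRing R] [Algebra ℚ R] (k : OddNat) (hk : k.1 ≠ 1)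
    (W : PDO R) (hW : W.IsDressing) (q r : Fn R) (h : BilinearIdentities k W q r) :
    ∃ V : PDO R, W * V = 1 ∧ V * W = 1 ∧
      ExtendedBKP k (W * PDO.partialX * V) q r ∧
      W.deriv (.t k) = -((W * PDO.partialX * V) ^ k.1).neg * W + ghost q r * W := by
  have hww : bilin k (applyExp W) (negLam (applyExp W)) = 1 := h.wave_wave
  have hWord : W.OrdLE 0 := hW.2
  have hzw : bilin k (pd .z (applyExp W)) (negLam (applyExp W)) =
    shift k q * shift' k r - shift k r * shift' k q := h.waveZ_wave
  have hshift1 : shift k (1 : Fn R) = 1 := by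
    rw [shift_eq_subst, ← MvPowerSeries.coe_substAlgHom (hasSubst_shiftVar k), map_one]
  have hshift0 : shift k (0 : Fn R) = 0 := by rw [← sub_self (1 : Fn R), shift_sub, sub_self]
  have hshift'1 : shift' k (1 : Fn R) = 1 := by
    rw [shift'_eq_subst, ← MvPowerSeries.coe_substAlgHom (hasSubst_shiftVar' k), map_one]
  -- the inverse of `W`
  have hinv : W * PDO.partialXInv * W.adjoint = PDO.partialXInv := by
    have hord : (W * PDO.partialXInv * W.adjoint).OrdLE (-1) :=
      (hWord.mul (PDO.ordLE_monomial (-1) 1)).mul hWord.adjoint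
    -- The right side `1` is read as `1 · 1' - 0 · 1'`. Derivatives of `1` vanish, so only the
    -- coefficient of `∂⁻¹` survives.
    have := coeff_of_bilin_wave hk (P := W) (Q := W) (a := 1) (b := 1) (c := 0) (d := 1)
      (by rw [hww, hshift1, hshift'1, hshift0, zero_mul, sub_zero, one_mul])
    ext1; funext i
    by_cases hi : -1 < i
    · rw [hord i hi, PDO.partialXInv, PDO.coeff_monomial_of_ne hi.ne']
    · obtain ⟨j, rfl⟩ : ∃ j : ℕ, i = -1 - j := ⟨(-1 - i).toNat, by omega⟩
      rw [this j, zero_mul, sub_zero, one_mul, PDO.partialXInv]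
      rcases eq_or_ne j 0 with rfl | hj
      · simp
      · rw [iterate_pd_one _ _ hj, mul_zero, PDO.coeff_monomial_of_ne (by omega)]
  obtain ⟨V, hV⟩ : ∃ V, V = PDO.partialXInv * W.adjoint * PDO.partialX := ⟨_, rfl⟩
  have hVord : V.OrdLE 0 := by
    rw [hV]
    exact ((PDO.ordLE_monomial (-1) 1).mul hWord.adjoint).mul (PDO.ordLE_monomial 1 1)
  have hWV : W * V = 1 := by
    rw [hV, ← mul_assoc, ← mul_assoc, hinv, PDO.partialXInv_mul_partialX]
  have hVW : V * W = 1 := PDO.mul_eq_one_of_isDressing hW hVord hWV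
  have hVinv : PDO.partialXInv * W.adjoint = V * PDO.partialXInv := by
    rw [hV, mul_assoc _ PDO.partialX, PDO.partialX_mul_partialXInv, mul_one]
  have hWadj : W.adjoint = PDO.partialX * V * PDO.partialXInv := by
    rw [mul_assoc, ← hVinv, PDO.partialX_mul_partialXInv_mul]
  -- the negative parts of `W_{t_n} W⁻¹ + L^n`
  have hcoeff : ∀ (P : PDO R) (j : ℕ), (P * PDO.partialXInv * W.adjoint).coeff (-1 - (j + 1 : ℕ)) =
      (P * V).coeff (-1 - j) := by
    intro P j
    -- As `∂⁻¹ W^* = V ∂⁻¹`, all indices move by one. The residue on the left would be the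
    -- coefficient of `∂^0` in `P V`, so the negative part of `P V` starts at `j + 1`.
    rw [mul_assoc, hVinv, ← mul_assoc, PDO.partialXInv, PDO.coeff_mul_monomial_one]
    congr 1
    push_cast
    ring
  have hmul : ∀ n : ℕ, ∀ v, (W.deriv v + W * PDO.partialX ^ n) * V =
      W.deriv v * V + (W * PDO.partialX * V) ^ n := fun n v => by
    rw [add_mul, PDO.dressing_pow hVW hWV]
  have hneg : ∀ v, (W.deriv v * V).OrdLE (-1) := fun v =>
    (PDO.ordLE_deriv_of_isDressing hW v).mul hVord
  have hflow : ∀ n : OddNat, n ≠ k →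
      (W.deriv (.t n) * V + (W * PDO.partialX * V) ^ n.1).neg = 0 := by
    intro n hn
    refine PDO.neg_eq_of_coeff (fun _ _ => rfl) fun j => ?_
    have h1 := congrArg (MvPowerSeries.pderiv R (Var2.t n)) hww
    rw [pderiv_t_bilin_of_ne hn, pd_t_applyExp, MvPowerSeries.pderiv_one] at h1
    have h2 := coeff_of_bilin_wave hk (a := 0) (b := 1) (c := 0) (d := 1)
      (by rw [h1, hshift0, zero_mul, sub_self]) (j + 1)
    rw [hcoeff, hmul] at h2
    rw [h2, zero_mul, sub_self, mul_zero]
    rfl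
  have hbar : (W.deriv (.t k) * V + (W * PDO.partialX * V) ^ k.1).neg = ghost q r := by
    refine PDO.neg_eq_of_coeff (PDO.ordLE_ghost q r) fun j => ?_
    -- The derivative of the constant `1` vanishes, so `w_z` may be exchanged for `w_{t̄_k}` in the
    -- second identity.
    have h1 := congrArg (MvPowerSeries.pderiv R (Var2.t k)) hww
    rw [pderiv_t_bilin_self, pd_t_applyExp, MvPowerSeries.pderiv_one, sub_eq_zero, hzw] at h1
    have h2 := coeff_of_bilin_wave hk h1 (j + 1)
    rw [hcoeff, hmul] at h2
    -- The index `j + 1` supplies the extra derivative in `q_x`, `r_x`, and its extra sign turns `q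
    -- r' - r q'` into the order of terms in `ghost`.
    rw [h2, ghost, PDO.coeff_sub, PDO.coeff_ofFn_mul_partialXInv_mul_ofFn,
      PDO.coeff_ofFn_mul_partialXInv_mul_ofFn, Function.iterate_succ_apply,
      Function.iterate_succ_apply]
    ring
  -- the Sato equations
  have hsato : ∀ (n : OddNat) (G : PDO R),
      (W.deriv (.t n) * V + (W * PDO.partialX * V) ^ n.1).neg = G →
      W.deriv (.t n) * V = -((W * PDO.partialX * V) ^ n.1).neg + G := by
    intro n G hG
    rw [PDO.neg_add_eq, PDO.neg_eq_self (hneg _)] at hG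
    rw [← hG]
    abel
  have hlax : ∀ (n : OddNat) (G : PDO R),
      (W.deriv (.t n) * V + (W * PDO.partialX * V) ^ n.1).neg = G →
      W.deriv (.t n) * V + (W * PDO.partialX * V) ^ n.1 =
        ((W * PDO.partialX * V) ^ n.1).pos + G := by
    intro n G hG
    rw [hsato n G hG]
    nth_rw 2 [← PDO.pos_add_neg ((W * PDO.partialX * V) ^ n.1)]
    abel
  have hB : ∀ n : OddNat, n ≠ k → W.deriv (.t n) + W * PDO.partialX ^ n.1 =
      ((W * PDO.partialX * V) ^ n.1).pos * W := by
    intro n hn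
    -- Multiplying the Sato equation by `W` on the right gives the linear equation `w_{t_n} = B_n
    -- w`, the form needed for the flows of `q` and `r`.
    have h1 := hlax n 0 (hflow n hn)
    rw [add_zero, ← hmul] at h1
    rw [← h1, mul_assoc, hVW, mul_one]
  have hL := PDO.dressing_eq_sub hWV
  have hWx : ∀ i, -1 < i → (W.deriv x * V).coeff i = 0 := hneg x
  refine ⟨V, hWV, hVW, ⟨?_, ?_, ?_, ?_, ?_, ?_, ?_, ?_⟩, ?_⟩
  · rw [hL, PDO.coeff_sub, hWx 1 (by omega), sub_zero, PDO.partialX, PDO.coeff_monomial_self]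
  · rw [hL, PDO.coeff_sub, hWx 0 (by omega), sub_zero, PDO.partialX,
      PDO.coeff_monomial_of_ne (by omega)]
  · intro i hi
    rw [hL, PDO.coeff_sub, hWx i (by omega), sub_zero, PDO.partialX,
      PDO.coeff_monomial_of_ne (by omega)]
  · exact PDO.deriv_dressing hVW hWV _ _ (hlax k _ hbar)
  · intro n hn
    refine PDO.deriv_dressing hVW hWV _ n.1 ?_
    rw [hlax n _ (hflow n hn), add_zero]
  · exact PDO.adjoint_dressing hWV hVW hWadj
  · exact fun n hn => pd_eq_act_of_bilin_wave hk hn (hB n hn) h.eq_q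
  · exact fun n hn => pd_eq_act_of_bilin_wave hk hn (hB n hn) h.eq_r
  · rw [← add_mul, ← hsato k _ hbar, mul_assoc, hVW, mul_one]
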